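/- **Theorem 6.1.** *Setting.* Let $N>1$, let $m$ be Lebesgue measure on $\mathbb R^N$, let $0<\alpha\le 1$ and $\tilde\varepsilon_0>0$. For a ball $B$ put $\mathrm{osc}(f,B)=\operatorname{ess\,sup}_B f-\operatorname{ess\,inf}_B f$, and let $$|f|_\alpha=\sup_{0<\varepsilon\le\tilde\varepsilon_0}\varepsilon^{-\alpha}\int_{\mathbb R^N}\mathrm{osc}(f,B_\varepsilon(x))\,dx,\qquad \|f\|_\alpha=\|f\|_{L^1}+|f|_\alpha .$$ For a compact set $C\subset\mathbb R^N$ with $\overline{\operatorname{int}C}\neq\emptyset$, $V_\alpha$ is the space of $f\in L^1(C)$ (extended by $0$ to $\mathbb R^N$) with $|f|_\alpha<\infty$. Let $\Omega$ be a topological space with a Borel probability measure $\mathbb P$, and $\sigma:\Omega\to\Omega$ an invertible (bi-measurable), ergodic, $\mathbb P$-preserving transformation. A *random Saussol map* over $\sigma$ is a family of maps $T_\omega:C\to C$ ($\omega\in\Omega$) for which there are $\varepsilon_0>0$, countably many open sets $U_i=U_{\omega,i}\subset C$, pairwise disjoint for each $\omega$, open sets $V_i=V_{\omega,i}\supset\overline{U_i}$,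 maps $T_{\omega,i}:V_i\to\mathbb R^N$, constants $S,c>0$ and a measurable function $s$ such that, for $\mathbb P$-a.e. $\omega$ and all $i$: * (PE1) $0<s(\omega)<S$; $|T_{\omega,i}^{-1}u-T_{\omega,i}^{-1}v|\le s(\omega)|u-v|$ for $u,v\in T_{\omega,i}V_i$ with $|u-v|\le\varepsilon_0$; and $\int\log s\,d\mathbb P<0$; * (PE2) $T_\omega=T_{\omega,i}$ on $U_i$, and $T_{\omega,i}V_i\supset B_{\varepsilon_0}(T_{\omega,i}U_i)$; * (PE3) $T_{\omega,i}$ is injective and $C^1$ with $C^1$ inverse, and $|\det DT_{\omega,i}^{-1}x-\det DT_{\omega,i}^{-1}y|\le c\,|\det DT_{\omega,i}^{-1}z|\,\varepsilon^\alpha$ whenever $0<\varepsilon\le\varepsilon_0$, $z\in T_{\omega,i}V_i$ and $x,y\in B_\varepsilon(z)\cap T_{\omega,i}V_i$; * (PE4) $m(C\setminus\bigcup_iU_i)=0$; * (PE5) $\int\log\zeta\,d\mathbb P<0$, where $\zeta(\omega)=s(\omega)^\alpha+2\sup_{0<\varepsilon\le\varepsilon_0}\frac{G_\omega(\varepsilon)}{\varepsilon^{\alpha}}(S\varepsilon_0)^\alpha$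 and $$G_\omega(\varepsilon)=\sup_{x\in C}\sum_i\frac{m\big(T_{\omega,i}^{-1}B_\varepsilon(\partial T_\omega U_i)\cap B_{(S-s(\omega))\varepsilon_0}(x)\big)}{m(B_{(S-s(\omega))\varepsilon_0}(x))};$$ and such that, for the transfer operators $\mathcal L_\omega f=\sum_i\big(\tfrac{f}{|\det DT_\omega|}\big)\circ T_{\omega,i}^{-1}\,1_{T_\omega U_i}$, the map $\omega\mapsto\mathcal L_\omega$ is $\mathbb P$-continuous, i.e. $\Omega$ is a countable union of Borel sets on each of which it is continuous in the operator norm of $V_\alpha$. Logarithmic integrals may take the value $-\infty$, and their positive parts are finite. Assume moreover that $\int\log^+\|\mathcal L_\omega\|_\alpha\,d\mathbb P<\infty$. *The functions $\Theta$.* Let $\eta:\Omega\to(0,\infty)$ be measurable and let $\tilde D$ be a constant such that, for $\mathbb P$-a.e. $\omega$ and all $f\in V_\alpha$, $$\|\mathcal L_\omega f\|_\alpha\le\eta(\omega)\|f\|_\alpha+\tilde D\|f\|_{L^1}.$$ Let $\tfrac12<\xi<1$ be such that $\int\log\eta\,d\mathbb P<\log\xi$ and $\tilde D\ge\xi\tilde\varepsilon_0^{-\alpha}$.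 Write $\eta^{(j)}(\sigma^{-j}\omega)=\eta(\sigma^{-1}\omega)\cdots\eta(\sigma^{-j}\omega)$, and for a.e. $\omega$ let $j_0(\omega)$ be such that $\eta^{(j)}(\sigma^{-j}\omega)<\xi^j$ for all $j\ge 1$ with $j\ge j_0(\omega)$. Put $$\theta(\omega)=\max\Big(1,\max_{1\le j\le j_0(\omega)}\frac{\eta^{(j)}(\sigma^{-j}\omega)}{\xi^j}\Big),\qquad \Theta(\omega)=\tilde D\,m(C)\Big(1+\frac{\theta(\omega)}{1-\xi}\Big).$$ *Statement.* Assume $m(C)\ge 1$. Let $r$ be the number of ergodic skew-product ACIPs, that is, of probability measures on $\Omega\times C$ that are absolutely continuous with respect to $\mathbb P\times m$, and invariant and ergodic under $F(\omega,x)=(\sigma\omega,T_\omega x)$. Then, for every function $\Theta$ obtained in this way, $r$ is finite and $$r\le\frac{m(C)}{\gamma_N}\ \operatorname*{ess\,inf}_{\omega\in\Omega}\ \Theta(\omega)^{N/\alpha},$$ where $\gamma_N$ is the volume of the unit ball of $\mathbb R^N$. -/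

import Mathlib

open MeasureTheory Set Topology
open scoped ENNReal

namespace Saussol

/-- Euclidean `N`-space. -/
abbrev E (N : ℕ) : Type := EuclideanSpace ℝ (Fin N)

/-! ### The space of bounded oscillation

Elements of `L¹(C)` are represented by functions on the whole space that vanish almost everywhere
outside `C`. All the quantities below only depend on the almost-everywhere class. -/

/-- The oscillation `ess sup_A f - ess inf_A f`, with value `∞` if `f` is essentially unbounded
on `A`. -/
noncomputable def osc {N : ℕ} (f : E N → ℝ) (A : Set (E N)) : ℝ≥0∞ :=
  (essSup (fun x => (f x : EReal)) (volume.restrict A) -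
    essInf (fun x => (f x : EReal)) (volume.restrict A)).toENNReal

/-- The `α`-seminorm `|f|_α = sup_{0 < ε ≤ e} ε^{-α} ∫ osc(f, B_ε(x)) dx`. -/
noncomputable def oscSeminorm {N : ℕ} (α e : ℝ) (f : E N → ℝ) : ℝ≥0∞ :=
  ⨆ ε ∈ Ioc (0 : ℝ) e, ENNReal.ofReal (ε ^ (-α)) * ∫⁻ x, osc f (Metric.ball x ε)

/-- The norm `‖f‖_α = ‖f‖_{L¹} + |f|_α`. -/
noncomputable def oscNorm {N : ℕ} (α e : ℝ) (f : E N → ℝ) : ℝ≥0∞ :=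
  eLpNorm f 1 volume + oscSeminorm α e f

/-- Membership in the space `V_α` of functions of bounded oscillation on `C`. -/
structure MemV {N : ℕ} (C : Set (E N)) (α e : ℝ) (f : E N → ℝ) : Prop where
  integrable : Integrable f volume
  eq_zero : ∀ᵐ x, x ∉ C → f x = 0
  finite : oscSeminorm α e f < ∞

/-! ### Logarithmic integrals -/

/-- `∫ log φ dP < log a`, where the integral may be `-∞` but its positive part has to be finite:
the integral of the positive part of `log (φ / a)` is smaller than that of the negative part. -/
def LogIntegralLT {Ω : Type*} [MeasurableSpace Ω] (P : Measure Ω) (φ : Ω → ℝ≥0∞) (a : ℝ≥0∞) :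
    Prop :=
  AEMeasurable φ P ∧
    ∫⁻ ω, (ENNReal.log (φ ω / a)).toENNReal ∂P < ∫⁻ ω, (-ENNReal.log (φ ω / a)).toENNReal ∂P

/-! ### Random Saussol maps -/

/-- A family of self-maps `T ω` of `C`, with the sets `U ω i ⊆ V ω i` and the branch maps
`branch ω i`, of which only the values on `V ω i` matter. The sets may depend on `ω` and
may be empty. -/
structure BranchedFamily (Ω ι : Type*) {N : ℕ} (C : Set (E N)) where
  T : Ω → C → C
  U : Ω → ι → Set (E N)
  V : Ω → ι → Set (E N)
  branch : Ω → ι → E N → E N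

namespace BranchedFamily

variable {Ω ι : Type*} {N : ℕ} {C : Set (E N)}

/-- The inverse of the `i`-th branch, defined on `branch ω i '' V ω i`. -/
noncomputable def inv (Φ : BranchedFamily Ω ι C) (ω : Ω) (i : ι) : E N → E N :=
  Function.invFunOn (Φ.branch ω i) (Φ.V ω i)

/-- The determinant of the derivative of the inverse branch. -/
noncomputable def invDet (Φ : BranchedFamily Ω ι C) (ω : Ω) (i : ι) (x : E N) : ℝ :=
  (fderiv ℝ (Φ.inv ω i) x).det

/-- The transfer operator
`(L_ω f)(x) = ∑_i 1_{T_ω U_i}(x) · f(y) / |det DT_ω(y)|`, with `y = T_{ω,i}⁻¹ x`. -/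
noncomputable def transfer (Φ : BranchedFamily Ω ι C) (ω : Ω) (f : E N → ℝ) (x : E N) : ℝ :=
  ∑' i, (Φ.branch ω i '' Φ.U ω i).indicator
    (fun x => |(fderiv ℝ (Φ.branch ω i) (Φ.inv ω i x)).det|⁻¹ * f (Φ.inv ω i x)) x

/-- The operator norm of the transfer operator on `V_α` (`∞` if it is unbounded). -/
noncomputable def transferNorm (Φ : BranchedFamily Ω ι C) (α e : ℝ) (ω : Ω) : ℝ≥0∞ :=
  sInf {M : ℝ≥0∞ | ∀ f, MemV C α e f → oscNorm α e (Φ.transfer ω f) ≤ M * oscNorm α e f}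

/-- `ω ↦ L_ω` is `ℙ`-continuous: `Ω` is a countable union of Borel sets on each of which the map
is continuous for the operator norm on `V_α`. -/
def IsPContinuous [TopologicalSpace Ω] [MeasurableSpace Ω] (Φ : BranchedFamily Ω ι C)
    (α e : ℝ) : Prop :=
  ∃ A : ℕ → Set Ω, (∀ n, MeasurableSet (A n)) ∧ (⋃ n, A n) = univ ∧
    ∀ n, ∀ ω₀ ∈ A n, ∀ δ > (0 : ℝ), ∀ᶠ ω in 𝓝[A n] ω₀, ∀ f, MemV C α e f →
      oscNorm α e (Φ.transfer ω f - Φ.transfer ω₀ f) ≤ ENNReal.ofReal δ * oscNorm α e f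

/-- `G_{ω,ε₀}(x, ε)`, the sum over the branches of the relative measures of
`T_{ω,i}⁻¹ B_ε(∂ T_ω U_i)` in the ball of radius `(S - s(ω)) ε₀` about `x`. -/
noncomputable def gAt (Φ : BranchedFamily Ω ι C) (ε₀ : ℝ) (s : Ω → ℝ) (S : ℝ) (ω : Ω)
    (x : E N) (ε : ℝ) : ℝ≥0∞ :=
  ∑' i, volume ((Φ.V ω i ∩ Φ.branch ω i ⁻¹'
        Metric.thickening ε (frontier (Φ.branch ω i '' Φ.U ω i))) ∩
      Metric.ball x ((S - s ω) * ε₀)) /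
    volume (Metric.ball x ((S - s ω) * ε₀))

/-- `G_{ω,ε₀}(ε) = sup_{x ∈ C} G_{ω,ε₀}(x, ε)`. -/
noncomputable def gSup (Φ : BranchedFamily Ω ι C) (ε₀ : ℝ) (s : Ω → ℝ) (S : ℝ) (ω : Ω)
    (ε : ℝ) : ℝ≥0∞ :=
  ⨆ x ∈ C, Φ.gAt ε₀ s S ω x ε

/-- `ζ_{ε₀}(ω) = s(ω)^α + 2 sup_{0 < ε ≤ ε₀} (G_{ω,ε₀}(ε) / ε^α) (S ε₀)^α`. -/
noncomputable def zeta (Φ : BranchedFamily Ω ι C) (α ε₀ : ℝ) (s : Ω → ℝ) (S : ℝ) (ω : Ω) :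
    ℝ≥0∞ :=
  ENNReal.ofReal (s ω ^ α) +
    2 * (⨆ ε ∈ Ioc (0 : ℝ) ε₀, Φ.gSup ε₀ s S ω ε / ENNReal.ofReal (ε ^ α)) *
      ENNReal.ofReal ((S * ε₀) ^ α)

/-- The family is a random Saussol map with exponent `α`, scale `ε₀`, contraction rates `s` of the
inverse branches, bounded by `S`, and Hölder constant `c` of the determinants. The number `e` is
the scale used in the norm of `V_α`; different values give equivalent norms. -/
structure IsRandomSaussol [TopologicalSpace Ω] [MeasurableSpace Ω] (Φ : BranchedFamily Ω ι C)
    (P : Measure Ω) (α ε₀ e : ℝ) (s : Ω → ℝ) (S c : ℝ) : Prop where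
  isOpen_U : ∀ ω i, IsOpen (Φ.U ω i)
  isOpen_V : ∀ ω i, IsOpen (Φ.V ω i)
  U_subset : ∀ ω i, Φ.U ω i ⊆ C
  disjoint_U : ∀ ω i j, i ≠ j → Disjoint (Φ.U ω i) (Φ.U ω j)
  closure_U : ∀ ω i, closure (Φ.U ω i) ⊆ Φ.V ω i
  -- average expansion
  S_pos : 0 < S
  s_bounds : ∀ᵐ ω ∂P, 0 < s ω ∧ s ω < S
  expanding : ∀ᵐ ω ∂P, ∀ i, ∀ x ∈ Φ.V ω i, ∀ y ∈ Φ.V ω i,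
    dist (Φ.branch ω i x) (Φ.branch ω i y) ≤ ε₀ →
      dist x y ≤ s ω * dist (Φ.branch ω i x) (Φ.branch ω i y)
  log_s_neg : LogIntegralLT P (fun ω => ENNReal.ofReal (s ω)) 1
  -- extension of the branches
  branch_eq : ∀ᵐ ω ∂P, ∀ i, ∀ x : C, (x : E N) ∈ Φ.U ω i → (Φ.T ω x : E N) = Φ.branch ω i x
  thickening_subset : ∀ᵐ ω ∂P, ∀ i,
    Metric.thickening ε₀ (Φ.branch ω i '' Φ.U ω i) ⊆ Φ.branch ω i '' Φ.V ω i
  -- regularity of the branches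
  contDiffOn_branch : ∀ᵐ ω ∂P, ∀ i, ContDiffOn ℝ 1 (Φ.branch ω i) (Φ.V ω i)
  injOn_branch : ∀ᵐ ω ∂P, ∀ i, InjOn (Φ.branch ω i) (Φ.V ω i)
  contDiffOn_inv : ∀ᵐ ω ∂P, ∀ i, ContDiffOn ℝ 1 (Φ.inv ω i) (Φ.branch ω i '' Φ.V ω i)
  c_pos : 0 < c
  holder_det : ∀ᵐ ω ∂P, ∀ i, ∀ ε ∈ Ioc (0 : ℝ) ε₀, ∀ z ∈ Φ.branch ω i '' Φ.V ω i,
    ∀ x ∈ Metric.ball z ε ∩ Φ.branch ω i '' Φ.V ω i,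
    ∀ y ∈ Metric.ball z ε ∩ Φ.branch ω i '' Φ.V ω i,
      |Φ.invDet ω i x - Φ.invDet ω i y| ≤ c * |Φ.invDet ω i z| * ε ^ α
  -- the pieces exhaust `C`
  covers : ∀ᵐ ω ∂P, volume (C \ ⋃ i, Φ.U ω i) = 0
  -- control of the boundaries
  log_zeta_neg : LogIntegralLT P (Φ.zeta α ε₀ s S) 1
  pContinuous : Φ.IsPContinuous α e

/-- The skew product `F(ω, x) = (σ ω, T_ω x)` on `Ω × C`. -/
def skewProduct (Φ : BranchedFamily Ω ι C) (σ : Ω → Ω) (p : Ω × C) : Ω × C :=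
  (σ p.1, Φ.T p.1 p.2)

/-- The ergodic skew-product ACIPs: the probability measures on `Ω × C` that are invariant and
ergodic for the skew product and absolutely continuous with respect to `P × m`. -/
def ergodicACIPs [MeasurableSpace Ω] (Φ : BranchedFamily Ω ι C) (σ : Ω → Ω) (P : Measure Ω) :
    Set (Measure (Ω × C)) :=
  {μ | IsProbabilityMeasure μ ∧ Ergodic (Φ.skewProduct σ) μ ∧
    μ ≪ P.prod ((volume : Measure (E N)).comap (fun x : C => (x : E N)))}

/-- `η` and the constant `D` are coefficients of a Lasota-Yorke inequality
`‖L_ω f‖_α ≤ η(ω) ‖f‖_α + D ‖f‖_{L¹}` on `V_α`, valid for almost every `ω`. -/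
def LasotaYorke [MeasurableSpace Ω] (Φ : BranchedFamily Ω ι C) (P : Measure Ω) (α e : ℝ)
    (η : Ω → ℝ) (D : ℝ) : Prop :=
  ∀ᵐ ω ∂P, ∀ f, MemV C α e f →
    oscNorm α e (Φ.transfer ω f) ≤
      ENNReal.ofReal (η ω) * oscNorm α e f + ENNReal.ofReal D * eLpNorm f 1 volume

end BranchedFamily

/-! ### The bound `Θ` -/

/-- `η^{(j)}(σ^{-j} ω) = η(σ^{-1} ω) η(σ^{-2} ω) ⋯ η(σ^{-j} ω)`. -/
def backProd {Ω : Type*} [MeasurableSpace Ω] (σ : Ω ≃ᵐ Ω) (η : Ω → ℝ) (j : ℕ) (ω : Ω) : ℝ :=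
  ∏ t ∈ Finset.Icc 1 j, η (σ.symm^[t] ω)

/-- `θ(ω) = max (1, max_{1 ≤ j ≤ j₀(ω)} η^{(j)}(σ^{-j} ω) / ξ^j)`. -/
noncomputable def theta {Ω : Type*} [MeasurableSpace Ω] (σ : Ω ≃ᵐ Ω) (η : Ω → ℝ) (ξ : ℝ)
    (j₀ : Ω → ℕ) (ω : Ω) : ℝ :=
  (Finset.Icc 1 (j₀ ω)).fold max 1 (fun j => backProd σ η j ω / ξ ^ j)

/-- `Θ(ω) = D m(C) (1 + θ(ω) / (1 - ξ))`. -/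
noncomputable def bigTheta {Ω : Type*} [MeasurableSpace Ω] {N : ℕ} (C : Set (E N))
    (σ : Ω ≃ᵐ Ω) (η : Ω → ℝ) (D ξ : ℝ) (j₀ : Ω → ℕ) (ω : Ω) : ℝ :=
  D * volume.real C * (1 + theta σ η ξ j₀ ω / (1 - ξ))

/-- `Θ` is one of the functions `D m(C) (1 + θ(ω) / (1 - ξ))` that bound the norms of the invariant
densities: it is formed from coefficients `η`, `D` of a Lasota-Yorke inequality with
`D ≥ ξ e^{-α}`, from a number `ξ ∈ (1/2, 1)` with `∫ log η dP < log ξ`, and from times `j₀(ω)`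
after which the backward products of `η` are smaller than the powers of `ξ`. -/
def IsTheta {Ω ι : Type*} [MeasurableSpace Ω] {N : ℕ} {C : Set (E N)}
    (Φ : BranchedFamily Ω ι C) (P : Measure Ω) (σ : Ω ≃ᵐ Ω) (α e : ℝ) (Θ : Ω → ℝ) : Prop :=
  ∃ (η : Ω → ℝ) (D ξ : ℝ) (j₀ : Ω → ℕ),
    Measurable η ∧ (∀ ω, 0 < η ω) ∧ Φ.LasotaYorke P α e η D ∧
    1 / 2 < ξ ∧ ξ < 1 ∧ ξ * e ^ (-α) ≤ D ∧
    LogIntegralLT P (fun ω => ENNReal.ofReal (η ω)) (ENNReal.ofReal ξ) ∧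
    (∀ᵐ ω ∂P, ∀ j, 1 ≤ j → j₀ ω ≤ j → backProd σ η j ω < ξ ^ j) ∧
    Θ = bigTheta C σ η D ξ j₀

end Saussol

/-!
By disintegration, an ergodic ACIP has fibre densities `H ω` with `L_ω (H ω) = H (σ ω)`. By
conservativity of `σ⁻¹`, `H (σ⁻ⁿω)` is infinitely often `L¹`-close to `H ω`, hence to a function
`φ ∈ V_α` approximating `H ω`. The transfer operators contract `L¹`, so they carry `φ` from the
fibre over `σ⁻ⁿω` to a function still close to `H ω`, whose oscillation is controlled by the
iterated Lasota–Yorke inequality. As `|·|_α` is lower semicontinuous, it follows that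
`|H ω|_α ≤ D θ(ω) / (1 - ξ) < Θ(ω)`. A density of integral one with this bound is positive almost
everywhere on some ball of radius `Θ(ω) ^ (-1/α)`: otherwise its oscillations at that scale would
dominate it pointwise and have integral at least one. Distinct ergodic measures are mutually
singular, so these balls are disjoint in `C`, and comparing volumes bounds their number.
-/

namespace Saussol

section Oscillation

variable {N : ℕ} {α e ε : ℝ} {f : E N → ℝ} {A B : Set (E N)}

theorem osc_le_iff {c : ℝ} (hc : 0 ≤ c) :
    osc f A ≤ ENNReal.ofReal c ↔
      ∀ᵐ y ∂volume.restrict A, ∀ᵐ z ∂volume.restrict A, f y - f z ≤ c := by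
  constructor
  · intro h
    filter_upwards [ae_le_essSup (μ := volume.restrict A) (f := fun x => (f x : EReal))] with y hy
    filter_upwards [ae_essInf_le (μ := volume.restrict A) (f := fun x => (f x : EReal))] with z hz
    have hyz : (f y - f z : EReal).toENNReal ≤ ENNReal.ofReal c :=
      (EReal.toENNReal_le_toENNReal (EReal.sub_le_sub hy hz)).trans h
    rwa [← EReal.coe_sub, EReal.real_coe_toENNReal, ENNReal.ofReal_le_ofReal_iff hc] at hyz
  · intro h
    rw [← EReal.real_coe_toENNReal]
    refine EReal.toENNReal_le_toENNReal (EReal.sub_le_of_le_add' (essSup_le_of_ae_le _ ?_))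
    filter_upwards [h] with y hy
    refine EReal.sub_le_iff_le_add (.inl (EReal.coe_ne_bot c)) (.inl (EReal.coe_ne_top c)) |>.1 ?_
    refine le_essInf_of_ae_le _ ?_
    filter_upwards [hy] with z hz
    exact EReal.coe_le_coe_iff.2 (sub_le_comm.1 hz)

theorem osc_le_of_forall {X : ℝ≥0∞}
    (h : ∀ c : ℝ, 0 ≤ c → X < ENNReal.ofReal c →
      ∀ᵐ y ∂volume.restrict A, ∀ᵐ z ∂volume.restrict A, f y - f z ≤ c) :
    osc f A ≤ X := by
  refine le_of_forall_gt_imp_ge_of_dense fun a ha => ?_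
  induction a with
  | top => exact le_top
  | coe r => simpa using (osc_le_iff r.2).2 (h r r.2 (by simpa using ha))

theorem osc_mono (h : A ⊆ B) : osc f A ≤ osc f B := by
  have hAB := Measure.restrict_mono h (le_refl (volume : Measure (E N)))
  exact EReal.toENNReal_le_toENNReal (EReal.sub_le_sub (essSup_mono_measure' hAB)
    (essInf_antitone_measure hAB.absolutelyContinuous))

theorem osc_iUnion_le_iSup {A : ℕ → Set (E N)} (hA : Monotone A) :
    osc f (⋃ n, A n) ≤ ⨆ n, osc f (A n) := by
  refine osc_le_of_forall fun c hc hX => ?_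
  have hosc : ∀ k, ∀ᵐ y ∂volume.restrict (A k), ∀ᵐ z ∂volume.restrict (A k), f y - f z ≤ c :=
    fun k => (osc_le_iff hc).1 ((le_iSup (fun n => osc f (A n)) k).trans hX.le)
  simp only [ae_restrict_iUnion_iff, ae_all_iff]
  intro m n
  have hm := ae_restrict_of_ae_restrict_of_subset (hA (le_max_left m n)) (hosc (max m n))
  filter_upwards [hm] with y hy
  exact ae_restrict_of_ae_restrict_of_subset (hA (le_max_right m n)) hy

theorem osc_le_liminf {u : ℕ → E N → ℝ}
    (hu : ∀ᵐ x, Filter.Tendsto (fun k => u k x) Filter.atTop (𝓝 (f x))) :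
    osc f A ≤ Filter.liminf (fun k => osc (u k) A) Filter.atTop := by
  refine osc_le_of_forall fun c hc hX => ?_
  have hfreq : ∃ᶠ k in Filter.atTop, osc (u k) A < ENNReal.ofReal c :=
    Filter.frequently_lt_of_liminf_lt (by isBoundedDefault) hX
  have hosc : ∀ᵐ y ∂volume.restrict A, ∀ k, osc (u k) A < ENNReal.ofReal c →
      ∀ᵐ z ∂volume.restrict A, u k y - u k z ≤ c := by
    simp only [ae_all_iff, Filter.eventually_imp_distrib_left]
    exact fun k hk => (osc_le_iff hc).1 hk.le
  filter_upwards [hosc, ae_restrict_of_ae hu] with y hy hyu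
  simp only [← Filter.eventually_imp_distrib_left, ← ae_all_iff] at hy
  filter_upwards [hy, ae_restrict_of_ae hu] with z hz hzu
  exact le_of_tendsto_of_frequently (hyu.sub hzu) (hfreq.mono hz)

theorem lowerSemicontinuous_osc_ball (f : E N → ℝ) (ε : ℝ) :
    LowerSemicontinuous fun x => osc f (Metric.ball x ε) := by
  intro x a ha
  let r : ℕ → ℝ := fun n => ε - 1 / (n + 1)
  have hr : Monotone r := fun m n hmn => sub_le_sub_left (Nat.one_div_le_one_div hmn) ε
  have hball : Metric.ball x ε = ⋃ n, Metric.ball x (r n) := by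
    ext y
    simp only [r, mem_iUnion, Metric.mem_ball, lt_sub_comm]
    exact ⟨fun hy => exists_nat_one_div_lt (sub_pos.2 hy),
      fun ⟨n, hn⟩ => sub_pos.1 (Nat.one_div_pos_of_nat.trans hn)⟩
  simp only [hball] at ha
  obtain ⟨n, hn⟩ := lt_iSup_iff.1
    (ha.trans_le (osc_iUnion_le_iSup fun m n hmn => Metric.ball_subset_ball (hr hmn)))
  filter_upwards [Metric.ball_mem_nhds x (Nat.one_div_pos_of_nat (α := ℝ) (n := n))] with y hy
  refine hn.trans_le (osc_mono (Metric.ball_subset ?_))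
  rw [Metric.mem_ball, dist_comm] at hy
  simp only [r]
  linarith

theorem measurable_osc_ball (f : E N → ℝ) (ε : ℝ) :
    Measurable fun x => osc f (Metric.ball x ε) :=
  (lowerSemicontinuous_osc_ball f ε).measurable

theorem mul_lintegral_osc_le_oscSeminorm (hε : ε ∈ Ioc 0 e) :
    ENNReal.ofReal (ε ^ (-α)) * ∫⁻ x, osc f (Metric.ball x ε) ≤ oscSeminorm α e f :=
  le_iSup₂ (f := fun ε (_ : ε ∈ Ioc (0 : ℝ) e) =>
    ENNReal.ofReal (ε ^ (-α)) * ∫⁻ x, osc f (Metric.ball x ε)) ε hε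

theorem oscSeminorm_le_liminf {u : ℕ → E N → ℝ}
    (hu : ∀ᵐ x, Filter.Tendsto (fun k => u k x) Filter.atTop (𝓝 (f x))) :
    oscSeminorm α e f ≤ Filter.liminf (fun k => oscSeminorm α e (u k)) Filter.atTop := by
  refine iSup₂_le fun ε hε => ?_
  calc ENNReal.ofReal (ε ^ (-α)) * ∫⁻ x, osc f (Metric.ball x ε)
      ≤ ENNReal.ofReal (ε ^ (-α)) *
          Filter.liminf (fun k => ∫⁻ x, osc (u k) (Metric.ball x ε)) Filter.atTop := by
        gcongr
        exact (lintegral_mono fun x => osc_le_liminf hu).trans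
          (lintegral_liminf_le fun k => measurable_osc_ball (u k) ε)
    _ = Filter.liminf
          (fun k => ENNReal.ofReal (ε ^ (-α)) * ∫⁻ x, osc (u k) (Metric.ball x ε))
          Filter.atTop :=
        (ENNReal.liminf_const_mul_of_ne_top ENNReal.ofReal_ne_top).symm
    _ ≤ Filter.liminf (fun k => oscSeminorm α e (u k)) Filter.atTop :=
        Filter.liminf_le_liminf <| Filter.Eventually.of_forall fun _ =>
          mul_lintegral_osc_le_oscSeminorm hε

theorem oscSeminorm_le_of_tendsto_eLpNorm {u : ℕ → E N → ℝ} {b : ℕ → ℝ≥0∞} {M : ℝ≥0∞}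
    (hum : ∀ l, AEStronglyMeasurable (u l) volume) (hf : AEStronglyMeasurable f volume)
    (hu : Filter.Tendsto (fun l => eLpNorm (u l - f) 1 volume) Filter.atTop (𝓝 0))
    (hub : ∀ l, oscSeminorm α e (u l) ≤ b l) (hb : Filter.Tendsto b Filter.atTop (𝓝 M)) :
    oscSeminorm α e f ≤ M := by
  obtain ⟨ns, hns, hlim⟩ :=
    (tendstoInMeasure_of_tendsto_eLpNorm one_ne_zero hum hf hu).exists_seq_tendsto_ae
  calc oscSeminorm α e f
      ≤ Filter.liminf (fun k => oscSeminorm α e (u (ns k))) Filter.atTop :=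
        oscSeminorm_le_liminf hlim
    _ ≤ Filter.liminf (fun k => b (ns k)) Filter.atTop :=
        Filter.liminf_le_liminf <| Filter.Eventually.of_forall fun k => hub (ns k)
    _ = M := (hb.comp hns.tendsto_atTop).liminf_eq

end Oscillation

section Positivity

theorem ae_le_essSup_ball {X β : Type*} [PseudoMetricSpace X] [TopologicalSpace.SeparableSpace X]
    [MeasurableSpace X] [OpensMeasurableSpace X] [CompleteLinearOrder β] [TopologicalSpace β]
    [FirstCountableTopology β] [OrderTopology β] (μ : Measure X) (f : X → β) {ε : ℝ}
    (hε : 0 < ε) : ∀ᵐ x ∂μ, f x ≤ essSup f (μ.restrict (Metric.ball x ε)) := by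
  obtain ⟨s, hs, hsd⟩ := TopologicalSpace.exists_countable_dense X
  have h : ∀ᵐ x ∂μ, ∀ c ∈ s, x ∈ Metric.ball c (ε / 2) →
      f x ≤ essSup f (μ.restrict (Metric.ball c (ε / 2))) :=
    (ae_ball_iff hs).2 fun c _ =>
      (ae_restrict_iff' Metric.isOpen_ball.measurableSet).1 ae_le_essSup
  filter_upwards [h] with x hx
  obtain ⟨c, hc, hxc⟩ := hsd.exists_dist_lt x (half_pos hε)
  refine (hx c hc hxc).trans (essSup_mono_measure' (Measure.restrict_mono ?_ le_rfl))
  refine Metric.ball_subset_ball' ?_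
  rw [dist_comm]
  linarith

variable {N : ℕ} {f : E N → ℝ}

theorem exists_ball_ae_pos {ε : ℝ} (hε : 0 < ε)
    (h : ∫⁻ x, osc f (Metric.ball x ε) < ∫⁻ x, ENNReal.ofReal (f x)) :
    ∃ x, ∀ᵐ y ∂volume.restrict (Metric.ball x ε), 0 < f y := by
  by_contra! hne
  refine h.not_ge (lintegral_mono_ae ?_)
  filter_upwards [ae_le_essSup_ball volume (fun x => (f x : EReal)) hε] with x hx
  have hinf : essInf (fun x => (f x : EReal)) (volume.restrict (Metric.ball x ε)) ≤ 0 := by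
    by_contra! hpos
    exact hne x ((ae_lt_of_lt_essInf hpos).mono fun y hy => not_le.2 (EReal.coe_pos.1 hy))
  simpa [osc] using EReal.toENNReal_le_toENNReal (EReal.sub_le_sub hx hinf)

theorem exists_ball_ae_pos_of_oscSeminorm_lt {α e T : ℝ} (hα : 0 < α) (he : 0 < e)
    (hT : e ^ (-α) ≤ T) (hf : ∫⁻ x, ENNReal.ofReal (f x) = 1)
    (h : oscSeminorm α e f < ENNReal.ofReal T) :
    ∃ x, ∀ᵐ y ∂volume.restrict (Metric.ball x (T ^ (-1 / α))), 0 < f y := by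
  have hT0 : 0 < T := (Real.rpow_pos_of_pos he _).trans_le hT
  have hpos : 0 < T ^ (-1 / α) := Real.rpow_pos_of_pos hT0 _
  have hexp : -α * (-1 / α) = 1 := by field_simp
  have hle : T ^ (-1 / α) ≤ e := by
    have := Real.rpow_le_rpow_of_nonpos (Real.rpow_pos_of_pos he _) hT
      (div_nonpos_of_nonpos_of_nonneg (by norm_num) hα.le : -1 / α ≤ 0)
    rwa [← Real.rpow_mul he.le, hexp, Real.rpow_one] at this
  refine exists_ball_ae_pos hpos ?_
  have hlt := (mul_lintegral_osc_le_oscSeminorm (α := α) (f := f) ⟨hpos, hle⟩).trans_lt h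
  rw [← Real.rpow_mul hT0.le, mul_comm, mul_comm (-1 / α), hexp, Real.rpow_one] at hlt
  rw [hf]
  by_contra! h1
  exact hlt.not_ge (le_mul_of_one_le_left' h1)

end Positivity

section Density

theorem enorm_sub_mul_le {χ : ℝ} (hχ : χ ∈ Icc 0 1) (a b : ℝ) :
    ‖a - χ * b‖ₑ ≤ ‖a‖ₑ + ‖a - b‖ₑ := by
  have hle : ∀ {t : ℝ}, t ∈ Icc 0 1 → ∀ c : ℝ, ‖t * c‖ₑ ≤ ‖c‖ₑ := fun {t} ht c => by
    rw [enorm_le_iff_norm_le, norm_mul, Real.norm_of_nonneg ht.1]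
    exact mul_le_of_le_one_left (norm_nonneg c) ht.2
  calc ‖a - χ * b‖ₑ = ‖(1 - χ) * a + χ * (a - b)‖ₑ := by ring_nf
    _ ≤ ‖(1 - χ) * a‖ₑ + ‖χ * (a - b)‖ₑ := enorm_add_le _ _
    _ ≤ ‖a‖ₑ + ‖a - b‖ₑ :=
      add_le_add (hle ⟨sub_nonneg.2 hχ.2, sub_le_self 1 hχ.1⟩ a) (hle hχ _)

open scoped ContDiff in
theorem exists_contDiff_eLpNorm_sub_le {V : Type*} [NormedAddCommGroup V] [NormedSpace ℝ V]
    [FiniteDimensional ℝ V] [MeasurableSpace V] [BorelSpace V] {μ : Measure V}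
    [IsFiniteMeasureOnCompacts μ] {W : Set V} (hW : IsOpen W) {f : V → ℝ} (hf : Integrable f μ)
    (hf0 : ∀ᵐ x ∂μ, x ∉ W → f x = 0) {δ : ℝ} (hδ : 0 < δ) :
    ∃ g : V → ℝ, ContDiff ℝ ∞ g ∧ HasCompactSupport g ∧ (∀ x, x ∉ W → g x = 0) ∧
      eLpNorm (f - g) 1 μ ≤ ENNReal.ofReal δ := by
  let ν := μ.withDensity (‖f ·‖ₑ)
  have : IsFiniteMeasure ν := isFiniteMeasure_withDensity hf.2.ne
  obtain ⟨K, hKW, hK, hKδ⟩ := hW.measurableSet.exists_isCompact_sdiff_lt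
    (measure_ne_top ν W) (ENNReal.ofReal_pos.2 (half_pos hδ)).ne'
  obtain ⟨χ, hχs, hχ0, hχ1, hχ⟩ : ∃ χ : V → ℝ, ContDiff ℝ ∞ χ ∧ (∀ x, x ∉ W → χ x = 0) ∧
      (∀ x ∈ K, χ x = 1) ∧ ∀ x, χ x ∈ Icc 0 1 := by
    obtain ⟨χ, hχ0, hχ1, hχ⟩ := exists_contMDiffMap_zero_one_of_isClosed (n := ⊤)
      (modelWithCornersSelf ℝ V) hW.isClosed_compl hK.isClosed
      (disjoint_compl_left_iff_subset.2 hKW)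
    exact ⟨χ, χ.contMDiff.contDiff, hχ0, hχ1, hχ⟩
  obtain ⟨φ, hφc, hφ, hfφ⟩ := (memLp_one_iff_integrable.2 hf).exist_eLpNorm_sub_le
    ENNReal.one_ne_top le_rfl (half_pos hδ)
  refine ⟨χ * φ, hχs.mul hφ, hφc.mul_left, fun x hx => ?_, ?_⟩
  · simp [hχ0 x hx]
  have hWK : MeasurableSet (W \ K) := hW.measurableSet.diff hK.measurableSet
  have hbound : ∀ᵐ x ∂μ, ‖(f - χ * φ) x‖ₑ ≤ (W \ K).indicator (‖f ·‖ₑ) x + ‖(f - φ) x‖ₑ := by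
    filter_upwards [hf0] with x hx
    by_cases hxW : x ∈ W
    · by_cases hxK : x ∈ K
      · simp [hχ1 x hxK]
      · rw [indicator_of_mem (show x ∈ W \ K from ⟨hxW, hxK⟩)]
        exact enorm_sub_mul_le (hχ x) (f x) (φ x)
    · simp [hx hxW, hχ0 x hxW]
  calc eLpNorm (f - χ * φ) 1 μ
      ≤ ∫⁻ x, (W \ K).indicator (‖f ·‖ₑ) x + ‖(f - φ) x‖ₑ ∂μ := by
        rw [eLpNorm_one_eq_lintegral_enorm]
        exact lintegral_mono_ae hbound
    _ = ν (W \ K) + eLpNorm (f - φ) 1 μ := by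
        rw [lintegral_add_left' (hf.1.enorm.indicator hWK), lintegral_indicator hWK,
          withDensity_apply _ hWK, eLpNorm_one_eq_lintegral_enorm]
    _ ≤ ENNReal.ofReal (δ / 2) + ENNReal.ofReal (δ / 2) := add_le_add hKδ.le hfφ
    _ = ENNReal.ofReal δ := by
        rw [← ENNReal.ofReal_add (half_pos hδ).le (half_pos hδ).le, add_halves]

variable {N : ℕ} {C : Set (E N)} {α e : ℝ} {f : E N → ℝ}

theorem osc_ball_le_of_lipschitzWith {K : NNReal} (hf : LipschitzWith K f) (x : E N) {ε : ℝ}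
    (hε : 0 ≤ ε) : osc f (Metric.ball x ε) ≤ ENNReal.ofReal (2 * K * ε) := by
  refine (osc_le_iff (by positivity)).2 ?_
  filter_upwards [ae_restrict_mem Metric.isOpen_ball.measurableSet] with y hy
  filter_upwards [ae_restrict_mem Metric.isOpen_ball.measurableSet] with z hz
  have hyz : dist y z ≤ 2 * ε := by
    linarith [dist_triangle_right y z x, Metric.mem_ball.1 hy, Metric.mem_ball.1 hz]
  calc f y - f z ≤ dist (f y) (f z) := Real.sub_le_dist _ _
    _ ≤ K * dist y z := hf.dist_le_mul y z
    _ ≤ K * (2 * ε) := by gcongr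
    _ = 2 * K * ε := by ring

theorem osc_ball_eq_zero (hf : ∀ x, x ∉ C → f x = 0) {x : E N} {ε : ℝ}
    (hx : x ∉ Metric.thickening ε C) : osc f (Metric.ball x ε) = 0 := by
  have h0 : ∀ y ∈ Metric.ball x ε, f y = 0 := fun y hy => hf y fun hyC =>
    hx (Metric.mem_thickening_iff.2 ⟨y, hyC, Metric.mem_ball'.1 hy⟩)
  rw [← nonpos_iff_eq_zero, ← ENNReal.ofReal_zero, osc_le_iff le_rfl]
  filter_upwards [ae_restrict_mem Metric.isOpen_ball.measurableSet] with y hy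
  filter_upwards [ae_restrict_mem Metric.isOpen_ball.measurableSet] with z hz
  simp [h0 y hy, h0 z hz]

theorem memV_of_lipschitzWith (hC : IsCompact C) (hα : α ≤ 1) {K : NNReal}
    (hf : LipschitzWith K f) (hf0 : ∀ x, x ∉ C → f x = 0) : MemV C α e f where
  integrable := hf.continuous.integrable_of_hasCompactSupport (HasCompactSupport.intro hC hf0)
  eq_zero := Filter.Eventually.of_forall hf0
  finite := by
    have hlintegral : ∀ ε ∈ Ioc (0 : ℝ) e, ∫⁻ x, osc f (Metric.ball x ε) ≤
        ENNReal.ofReal (2 * K * ε) * volume (Metric.thickening e C) := fun ε hε => by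
      rw [← setLIntegral_const, ← lintegral_indicator Metric.isOpen_thickening.measurableSet]
      refine lintegral_mono fun x => ?_
      by_cases hx : x ∈ Metric.thickening e C
      · rw [indicator_of_mem hx]
        exact osc_ball_le_of_lipschitzWith hf x hε.1.le
      · rw [osc_ball_eq_zero hf0 fun h => hx (Metric.thickening_mono hε.2 C h)]
        exact zero_le
    have hle : oscSeminorm α e f ≤
        ENNReal.ofReal (e ^ (1 - α) * (2 * K)) * volume (Metric.thickening e C) := by
      refine iSup₂_le fun ε hε => (mul_le_mul_right (hlintegral ε hε) _).trans ?_
      rw [← mul_assoc, ← ENNReal.ofReal_mul (Real.rpow_nonneg hε.1.le _)]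
      refine mul_le_mul_left (ENNReal.ofReal_le_ofReal ?_) _
      calc ε ^ (-α) * (2 * K * ε) = ε ^ (1 - α) * (2 * K) := by
            rw [sub_eq_neg_add, Real.rpow_add hε.1, Real.rpow_one]
            ring
        _ ≤ e ^ (1 - α) * (2 * K) := by
            gcongr
            exacts [hε.1.le, hε.2]
    exact hle.trans_lt
      (ENNReal.mul_lt_top ENNReal.ofReal_lt_top hC.isBounded.thickening.measure_lt_top)

theorem exists_memV_eLpNorm_sub_le (hC : IsCompact C) (hCi : volume (C \ interior C) = 0)
    (hα : α ≤ 1) (hf : Integrable f) (hf0 : ∀ᵐ x, x ∉ C → f x = 0) {δ : ℝ} (hδ : 0 < δ) :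
    ∃ g, MemV C α e g ∧ eLpNorm (f - g) 1 volume ≤ ENNReal.ofReal δ := by
  have hf0' : ∀ᵐ x, x ∉ interior C → f x = 0 := by
    filter_upwards [hf0, measure_eq_zero_iff_ae_notMem.1 hCi] with x hx hxC hxi
    exact hx fun h => hxC ⟨h, hxi⟩
  obtain ⟨g, hg, hgc, hg0, hfg⟩ := exists_contDiff_eLpNorm_sub_le isOpen_interior hf hf0' hδ
  obtain ⟨K, hK⟩ := hg.lipschitzWith_of_hasCompactSupport hgc (by simp)
  exact ⟨g, memV_of_lipschitzWith hC hα hK fun x hx => hg0 x fun h => hx (interior_subset h), hfg⟩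

end Density

section Recurrence

theorem ae_frequently_eLpNorm_sub_lt {Ω X : Type*} [MeasurableSpace Ω] [MeasurableSpace X]
    {P : Measure Ω} {μ : Measure X} [SFinite μ] [IsSeparable μ] {f : Ω → Ω}
    (hf : Conservative f P) {H : Ω → X → ℝ} (hH : Measurable (Function.uncurry H)) :
    ∀ᵐ ω ∂P, Integrable (H ω) μ → ∀ δ : ℝ≥0∞, δ ≠ 0 →
      ∃ᶠ n in Filter.atTop, eLpNorm (H (f^[n] ω) - H ω) 1 μ < δ := by
  have : Fact ((1 : ℝ≥0∞) ≠ ∞) := ⟨ENNReal.one_ne_top⟩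
  let φ := TopologicalSpace.denseSeq (Lp ℝ 1 μ)
  let A : ℕ → ℕ → Set Ω := fun k m => {ω | eLpNorm (H ω - ⇑(φ k)) 1 μ < (m : ℝ≥0∞)⁻¹}
  have hA : ∀ k m, MeasurableSet (A k m) := fun k m => by
    refine measurableSet_lt ?_ measurable_const
    simp only [eLpNorm_one_eq_lintegral_enorm]
    exact ((hH.sub ((Lp.stronglyMeasurable (φ k)).measurable.comp measurable_snd)).enorm
      ).lintegral_prod_right'
  have hrec : ∀ᵐ ω ∂P, ∀ k m, ω ∈ A k m → ∃ᶠ n in Filter.atTop, f^[n] ω ∈ A k m :=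
    ae_all_iff.2 fun k => ae_all_iff.2 fun m =>
      hf.ae_mem_imp_frequently_image_mem (hA k m).nullMeasurableSet
  have hmeas : ∀ ω k, AEStronglyMeasurable (H ω - ⇑(φ k)) μ := fun ω k =>
    hH.of_uncurry_left.aestronglyMeasurable.sub (Lp.aestronglyMeasurable (φ k))
  filter_upwards [hrec] with ω hω hint δ hδ
  obtain ⟨m, hm⟩ := ENNReal.exists_inv_nat_lt (ENNReal.half_pos hδ).ne'
  obtain ⟨k, hk⟩ : ∃ k, ω ∈ A k m := by
    have hLp := memLp_one_iff_integrable.2 hint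
    obtain ⟨k, hk⟩ := (TopologicalSpace.denseRange_denseSeq (Lp ℝ 1 μ)).exists_mem_open
      Metric.isOpen_eball
      ⟨hLp.toLp, Metric.mem_eball_self (ENNReal.inv_pos.2 (ENNReal.natCast_ne_top m))⟩
    rw [Metric.mem_eball', Lp.edist_def, eLpNorm_congr_ae (hLp.coeFn_toLp.sub ae_eq_rfl)] at hk
    exact ⟨k, hk⟩
  refine (hω k m hk).mono fun n hn => ?_
  calc eLpNorm (H (f^[n] ω) - H ω) 1 μ
      = eLpNorm ((H (f^[n] ω) - ⇑(φ k)) - (H ω - ⇑(φ k))) 1 μ := by rw [sub_sub_sub_cancel_right]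
    _ ≤ eLpNorm (H (f^[n] ω) - ⇑(φ k)) 1 μ + eLpNorm (H ω - ⇑(φ k)) 1 μ :=
        eLpNorm_sub_le (hmeas _ k) (hmeas _ k) le_rfl
    _ < δ / 2 + δ / 2 := ENNReal.add_lt_add (hn.trans hm) (hk.trans hm)
    _ = δ := ENNReal.add_halves δ

end Recurrence

section FDeriv

variable {F : Type*} [NormedAddCommGroup F] [NormedSpace ℝ F]

theorem det_fderiv_ne_zero_of_leftInvOn {f g : F → F} {s : Set F} {y : F} (hs : s ∈ 𝓝 y)
    (hf : DifferentiableAt ℝ f y) (hg : DifferentiableWithinAt ℝ g (f '' s) (f y))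
    (hgf : LeftInvOn g f s) : (fderiv ℝ f y).det ≠ 0 := by
  have hcomp : HasFDerivAt (g ∘ f)
      ((fderivWithin ℝ g (f '' s) (f y)).comp (fderiv ℝ f y)) y :=
    (hg.hasFDerivWithinAt.comp y hf.hasFDerivAt.hasFDerivWithinAt (mapsTo_image f s)).hasFDerivAt hs
  have hid : HasFDerivAt (g ∘ f) (ContinuousLinearMap.id ℝ F) y :=
    (hasFDerivAt_id y).congr_of_eventuallyEq (Filter.eventually_of_mem hs hgf)
  have hdet := congrArg ContinuousLinearMap.det (hcomp.unique hid)
  simp only [ContinuousLinearMap.det, ContinuousLinearMap.toLinearMap_comp, LinearMap.det_comp,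
    ContinuousLinearMap.coe_id, LinearMap.det_id] at hdet ⊢
  exact right_ne_zero_of_mul_eq_one hdet

end FDeriv

namespace BranchedFamily

variable {Ω ι : Type*} {N : ℕ} {C : Set (E N)}

/-- The conditions on a single fibre map under which its transfer operator is the dual of
composition with the map: outside a null subset of `C`, the map is given by `C¹` diffeomorphisms
of disjoint open sets. -/
structure RegularFiber (Φ : BranchedFamily Ω ι C) (ω : Ω) : Prop where
  isOpen_U : ∀ i, IsOpen (Φ.U ω i)
  isOpen_V : ∀ i, IsOpen (Φ.V ω i)
  U_subset : ∀ i, Φ.U ω i ⊆ C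
  disjoint_U : Pairwise (Function.onFun Disjoint (Φ.U ω))
  U_subset_V : ∀ i, Φ.U ω i ⊆ Φ.V ω i
  branch_eq : ∀ i, ∀ x : C, (x : E N) ∈ Φ.U ω i → (Φ.T ω x : E N) = Φ.branch ω i x
  contDiffOn_branch : ∀ i, ContDiffOn ℝ 1 (Φ.branch ω i) (Φ.V ω i)
  injOn_branch : ∀ i, InjOn (Φ.branch ω i) (Φ.V ω i)
  contDiffOn_inv : ∀ i, ContDiffOn ℝ 1 (Φ.inv ω i) (Φ.branch ω i '' Φ.V ω i)
  covers : volume (C \ ⋃ i, Φ.U ω i) = 0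

theorem IsRandomSaussol.ae_regularFiber [TopologicalSpace Ω] [MeasurableSpace Ω]
    {Φ : BranchedFamily Ω ι C} {P : Measure Ω} {α ε₀ e : ℝ} {s : Ω → ℝ} {S c : ℝ}
    (h : Φ.IsRandomSaussol P α ε₀ e s S c) : ∀ᵐ ω ∂P, Φ.RegularFiber ω := by
  filter_upwards [h.branch_eq, h.contDiffOn_branch, h.injOn_branch, h.contDiffOn_inv, h.covers]
    with ω hT hbranch hinj hinv hcov
  exact ⟨h.isOpen_U ω, h.isOpen_V ω, h.U_subset ω, h.disjoint_U ω,
    fun i => subset_closure.trans (h.closure_U ω i), hT, hbranch, hinj, hinv, hcov⟩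

/-- The contribution of the `i`-th branch to the transfer operator. -/
noncomputable def branchTransfer (Φ : BranchedFamily Ω ι C) (ω : Ω) (i : ι) (f : E N → ℝ) :
    E N → ℝ :=
  (Φ.branch ω i '' Φ.U ω i).indicator
    (fun x => |(fderiv ℝ (Φ.branch ω i) (Φ.inv ω i x)).det|⁻¹ * f (Φ.inv ω i x))

theorem transfer_eq_tsum (Φ : BranchedFamily Ω ι C) (ω : Ω) (f : E N → ℝ) (x : E N) :
    Φ.transfer ω f x = ∑' i, Φ.branchTransfer ω i f x := rfl

theorem branchTransfer_nonneg (Φ : BranchedFamily Ω ι C) (ω : Ω) (i : ι) {f : E N → ℝ}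
    (hf : ∀ x, 0 ≤ f x) (x : E N) : 0 ≤ Φ.branchTransfer ω i f x :=
  indicator_nonneg (fun _ _ => mul_nonneg (by positivity) (hf _)) x

theorem transfer_nonneg (Φ : BranchedFamily Ω ι C) (ω : Ω) {f : E N → ℝ}
    (hf : ∀ x, 0 ≤ f x) (x : E N) : 0 ≤ Φ.transfer ω f x :=
  tsum_nonneg fun i => Φ.branchTransfer_nonneg ω i hf x

theorem branchTransfer_sub (Φ : BranchedFamily Ω ι C) (ω : Ω) (i : ι) (f g : E N → ℝ) :
    Φ.branchTransfer ω i (f - g) = Φ.branchTransfer ω i f - Φ.branchTransfer ω i g := by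
  simp only [branchTransfer, Pi.sub_apply, mul_sub]
  exact indicator_sub _ _ _

namespace RegularFiber

variable {Φ : BranchedFamily Ω ι C} {ω : Ω}

theorem volume_diff_interior (h : Φ.RegularFiber ω) : volume (C \ interior C) = 0 :=
  measure_mono_null (sdiff_subset_sdiff_right (iUnion_subset fun i =>
    (h.isOpen_U i).subset_interior_iff.2 (h.U_subset i))) h.covers

theorem leftInvOn_inv (h : Φ.RegularFiber ω) (i : ι) :
    LeftInvOn (Φ.inv ω i) (Φ.branch ω i) (Φ.V ω i) :=
  (h.injOn_branch i).leftInvOn_invFunOn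

theorem differentiableAt_branch (h : Φ.RegularFiber ω) (i : ι) {y : E N} (hy : y ∈ Φ.V ω i) :
    DifferentiableAt ℝ (Φ.branch ω i) y :=
  ((h.contDiffOn_branch i).differentiableOn one_ne_zero).differentiableAt
    ((h.isOpen_V i).mem_nhds hy)

theorem hasFDerivWithinAt_branch (h : Φ.RegularFiber ω) (i : ι) :
    ∀ y ∈ Φ.U ω i,
      HasFDerivWithinAt (Φ.branch ω i) (fderiv ℝ (Φ.branch ω i) y) (Φ.U ω i) y :=
  fun _ hy => (h.differentiableAt_branch i (h.U_subset_V i hy)).hasFDerivAt.hasFDerivWithinAt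

theorem det_fderiv_branch_ne_zero (h : Φ.RegularFiber ω) (i : ι) {y : E N}
    (hy : y ∈ Φ.V ω i) : (fderiv ℝ (Φ.branch ω i) y).det ≠ 0 :=
  det_fderiv_ne_zero_of_leftInvOn ((h.isOpen_V i).mem_nhds hy) (h.differentiableAt_branch i hy)
    ((h.contDiffOn_inv i).differentiableOn one_ne_zero _ (mem_image_of_mem _ hy))
    (h.leftInvOn_inv i)

theorem branchTransfer_branch (h : Φ.RegularFiber ω) (i : ι) (f : E N → ℝ) {y : E N}
    (hy : y ∈ Φ.U ω i) : Φ.branchTransfer ω i f (Φ.branch ω i y) =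
      |(fderiv ℝ (Φ.branch ω i) y).det|⁻¹ * f y := by
  rw [branchTransfer, indicator_of_mem (mem_image_of_mem _ hy),
    h.leftInvOn_inv i (h.U_subset_V i hy)]

theorem measurableSet_image_U (h : Φ.RegularFiber ω) (i : ι) :
    MeasurableSet (Φ.branch ω i '' Φ.U ω i) :=
  measurable_image_of_fderivWithin (h.isOpen_U i).measurableSet (h.hasFDerivWithinAt_branch i)
    ((h.injOn_branch i).mono (h.U_subset_V i))

theorem lintegral_enorm_branchTransfer_mul (h : Φ.RegularFiber ω) (i : ι) (f : E N → ℝ)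
    (G : E N → ℝ≥0∞) :
    ∫⁻ x, ‖Φ.branchTransfer ω i f x‖ₑ * G x = ∫⁻ y in Φ.U ω i, ‖f y‖ₑ * G (Φ.branch ω i y) := by
  have hsupp : Function.support (fun x => ‖Φ.branchTransfer ω i f x‖ₑ * G x) ⊆
      Φ.branch ω i '' Φ.U ω i := fun x hx => by
    by_contra hxU
    exact hx (by simp [branchTransfer, indicator_of_notMem hxU])
  rw [← setLIntegral_eq_of_support_subset hsupp,
    lintegral_image_eq_lintegral_abs_det_fderiv_mul _ (h.isOpen_U i).measurableSet
      (h.hasFDerivWithinAt_branch i) ((h.injOn_branch i).mono (h.U_subset_V i))]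
  refine setLIntegral_congr_fun (h.isOpen_U i).measurableSet fun y hy => ?_
  have hdet := abs_pos.2 (h.det_fderiv_branch_ne_zero i (h.U_subset_V i hy))
  rw [h.branchTransfer_branch i f hy, enorm_mul, Real.enorm_of_nonneg (inv_nonneg.2 hdet.le),
    ← mul_assoc, ← mul_assoc, ← ENNReal.ofReal_mul hdet.le, mul_inv_cancel₀ hdet.ne',
    ENNReal.ofReal_one, one_mul]

theorem branchTransfer_congr_ae (h : Φ.RegularFiber ω) (i : ι) {f g : E N → ℝ}
    (hfg : f =ᵐ[volume] g) : Φ.branchTransfer ω i f =ᵐ[volume] Φ.branchTransfer ω i g := by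
  have hnull : volume (Φ.branch ω i '' ({x | ¬ f x = g x} ∩ Φ.U ω i)) = 0 :=
    addHaar_image_eq_zero_of_differentiableOn_of_addHaar_eq_zero _
      (fun y hy => (h.differentiableAt_branch i (h.U_subset_V i hy.2)).differentiableWithinAt)
      (measure_mono_null inter_subset_left hfg)
  filter_upwards [measure_eq_zero_iff_ae_notMem.1 hnull] with x hx
  by_cases hxU : x ∈ Φ.branch ω i '' Φ.U ω i
  · obtain ⟨y, hy, rfl⟩ := hxU
    rw [h.branchTransfer_branch i f hy, h.branchTransfer_branch i g hy]
    congr 1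
    by_contra hne
    exact hx (mem_image_of_mem _ ⟨hne, hy⟩)
  · rw [branchTransfer, branchTransfer, indicator_of_notMem hxU, indicator_of_notMem hxU]

theorem mapsTo_inv (h : Φ.RegularFiber ω) (i : ι) :
    MapsTo (Φ.inv ω i) (Φ.branch ω i '' Φ.U ω i) (Φ.V ω i) := by
  rintro _ ⟨y, hy, rfl⟩
  rw [h.leftInvOn_inv i (h.U_subset_V i hy)]
  exact h.U_subset_V i hy

theorem continuousOn_inv (h : Φ.RegularFiber ω) (i : ι) :
    ContinuousOn (Φ.inv ω i) (Φ.branch ω i '' Φ.U ω i) :=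
  (h.contDiffOn_inv i).continuousOn.mono (image_mono (h.U_subset_V i))

theorem continuousOn_inv_abs_det (h : Φ.RegularFiber ω) (i : ι) :
    ContinuousOn (fun x => |(fderiv ℝ (Φ.branch ω i) (Φ.inv ω i x)).det|⁻¹)
      (Φ.branch ω i '' Φ.U ω i) :=
  (ContinuousLinearMap.continuous_det.comp_continuousOn
    (((h.contDiffOn_branch i).continuousOn_fderiv_of_isOpen (h.isOpen_V i) le_rfl).comp
      (h.continuousOn_inv i) (h.mapsTo_inv i))).abs.inv₀
    fun _ hx => abs_ne_zero.2 (h.det_fderiv_branch_ne_zero i (h.mapsTo_inv i hx))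

theorem aestronglyMeasurable_branchTransfer (h : Φ.RegularFiber ω) (i : ι) {f : E N → ℝ}
    (hf : AEStronglyMeasurable f volume) :
    AEStronglyMeasurable (Φ.branchTransfer ω i f) volume := by
  refine AEStronglyMeasurable.congr (AEMeasurable.aestronglyMeasurable ?_)
    (h.branchTransfer_congr_ae i hf.ae_eq_mk.symm)
  have hU := h.measurableSet_image_U i
  rw [branchTransfer, aemeasurable_indicator_iff hU]
  exact ((h.continuousOn_inv_abs_det i).aemeasurable hU).mul
    (hf.stronglyMeasurable_mk.measurable.comp_aemeasurable ((h.continuousOn_inv i).aemeasurable hU))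

theorem tsum_setLIntegral [Countable ι] (h : Φ.RegularFiber ω) (F : E N → ℝ≥0∞) :
    ∑' i, ∫⁻ y in Φ.U ω i, F y = ∫⁻ y in C, F y := by
  rw [← lintegral_iUnion (fun i => (h.isOpen_U i).measurableSet) h.disjoint_U]
  exact setLIntegral_congr ((iUnion_subset h.U_subset).eventuallyLE.antisymm (ae_le_set.2 h.covers))

theorem lintegral_tsum_enorm_branchTransfer [Countable ι] (h : Φ.RegularFiber ω) {f : E N → ℝ}
    (hf : AEStronglyMeasurable f volume) :
    ∫⁻ x, ∑' i, ‖Φ.branchTransfer ω i f x‖ₑ = ∫⁻ y in C, ‖f y‖ₑ := by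
  rw [lintegral_tsum fun i => (h.aestronglyMeasurable_branchTransfer i hf).enorm]
  simpa only [Pi.one_apply, mul_one] using (tsum_congr fun i =>
    h.lintegral_enorm_branchTransfer_mul i f 1).trans (h.tsum_setLIntegral fun y => ‖f y‖ₑ * 1)

theorem ae_summable_branchTransfer [Countable ι] (h : Φ.RegularFiber ω) {f : E N → ℝ}
    (hf : Integrable f) : ∀ᵐ x, Summable fun i => Φ.branchTransfer ω i f x := by
  have hfin : ∫⁻ x, ∑' i, ‖Φ.branchTransfer ω i f x‖ₑ ≠ ∞ := by
    rw [h.lintegral_tsum_enorm_branchTransfer hf.1]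
    exact hf.restrict.2.ne
  filter_upwards [ae_lt_top' (AEMeasurable.tsum fun i =>
    (h.aestronglyMeasurable_branchTransfer i hf.1).enorm) hfin] with x hx
  exact .of_norm (NNReal.summable_coe.2 (ENNReal.tsum_coe_ne_top_iff_summable.1 hx.ne))

theorem aestronglyMeasurable_transfer [Countable ι] (h : Φ.RegularFiber ω) {f : E N → ℝ}
    (hf : Integrable f) : AEStronglyMeasurable (Φ.transfer ω f) volume := by
  refine aestronglyMeasurable_of_tendsto_ae Filter.atTop
    (f := fun (s : Finset ι) x => ∑ i ∈ s, Φ.branchTransfer ω i f x)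
    (fun s => Finset.aestronglyMeasurable_fun_sum s
      fun i _ => h.aestronglyMeasurable_branchTransfer i hf.1) ?_
  filter_upwards [h.ae_summable_branchTransfer hf] with x hx using hx.hasSum

theorem eLpNorm_transfer_le [Countable ι] (h : Φ.RegularFiber ω) {f : E N → ℝ}
    (hf : AEStronglyMeasurable f volume) :
    eLpNorm (Φ.transfer ω f) 1 volume ≤ eLpNorm f 1 volume := by
  rw [eLpNorm_one_eq_lintegral_enorm, eLpNorm_one_eq_lintegral_enorm]
  calc ∫⁻ x, ‖Φ.transfer ω f x‖ₑ
      ≤ ∫⁻ x, ∑' i, ‖Φ.branchTransfer ω i f x‖ₑ := lintegral_mono fun _ => enorm_tsum_le_tsum_enorm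
    _ = ∫⁻ y in C, ‖f y‖ₑ := h.lintegral_tsum_enorm_branchTransfer hf
    _ ≤ ∫⁻ y, ‖f y‖ₑ := setLIntegral_le_lintegral _ _

theorem integrable_transfer [Countable ι] (h : Φ.RegularFiber ω) {f : E N → ℝ}
    (hf : Integrable f) : Integrable (Φ.transfer ω f) :=
  memLp_one_iff_integrable.1 ⟨h.aestronglyMeasurable_transfer hf,
    (h.eLpNorm_transfer_le hf.1).trans_lt (memLp_one_iff_integrable.2 hf).2⟩

theorem transfer_sub [Countable ι] (h : Φ.RegularFiber ω) {f g : E N → ℝ}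
    (hf : Integrable f) (hg : Integrable g) :
    Φ.transfer ω (f - g) =ᵐ[volume] Φ.transfer ω f - Φ.transfer ω g := by
  filter_upwards [h.ae_summable_branchTransfer hf, h.ae_summable_branchTransfer hg] with x hfx hgx
  simp only [transfer_eq_tsum, branchTransfer_sub, Pi.sub_apply]
  exact hfx.tsum_sub hgx

theorem eLpNorm_transfer_sub_le [Countable ι] (h : Φ.RegularFiber ω) {f g : E N → ℝ}
    (hf : Integrable f) (hg : Integrable g) :
    eLpNorm (Φ.transfer ω f - Φ.transfer ω g) 1 volume ≤ eLpNorm (f - g) 1 volume :=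
  (eLpNorm_congr_ae (h.transfer_sub hf hg)).symm.trans_le (h.eLpNorm_transfer_le (hf.sub hg).1)

theorem transfer_eq_zero (h : Φ.RegularFiber ω) (f : E N → ℝ) {x : E N} (hx : x ∉ C) :
    Φ.transfer ω f x = 0 := by
  have hbranch : ∀ i, Φ.branchTransfer ω i f x = 0 := fun i => indicator_of_notMem (by
    rintro ⟨y, hy, rfl⟩
    exact hx (h.branch_eq i ⟨y, h.U_subset i hy⟩ hy ▸ Subtype.coe_prop _)) _
  simp only [transfer_eq_tsum, hbranch, tsum_zero]

attribute [local instance] Measure.Subtype.measureSpace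

theorem lintegral_enorm_transfer_mul [Countable ι] (h : Φ.RegularFiber ω) (hC : MeasurableSet C)
    {f : E N → ℝ} (hf : Integrable f) (hf0 : ∀ x, 0 ≤ f x) {G : E N → ℝ≥0∞} (hG : Measurable G) :
    ∫⁻ x, ‖Φ.transfer ω f x‖ₑ * G x = ∫⁻ y : C, ‖f y‖ₑ * G (Φ.T ω y) := by
  have htsum : ∀ᵐ x, ‖Φ.transfer ω f x‖ₑ * G x = ∑' i, ‖Φ.branchTransfer ω i f x‖ₑ * G x := by
    filter_upwards [h.ae_summable_branchTransfer hf] with x hx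
    have hnonneg := fun i => Φ.branchTransfer_nonneg ω i hf0 x
    rw [Real.enorm_of_nonneg (Φ.transfer_nonneg ω hf0 x), transfer_eq_tsum,
      ENNReal.ofReal_tsum_of_nonneg hnonneg hx, ENNReal.tsum_mul_right]
    simp only [Real.enorm_of_nonneg (hnonneg _)]
  let GT : E N → ℝ≥0∞ := Function.extend Subtype.val (fun y : C => G (Φ.T ω y)) 0
  have hGT : ∀ y : C, GT y = G (Φ.T ω y) := Subtype.val_injective.extend_apply _ _
  have hbranch : ∀ i, ∫⁻ x, ‖Φ.branchTransfer ω i f x‖ₑ * G x =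
      ∫⁻ y in Φ.U ω i, ‖f y‖ₑ * GT y := fun i => by
    rw [h.lintegral_enorm_branchTransfer_mul]
    refine setLIntegral_congr_fun (h.isOpen_U i).measurableSet fun y hy => ?_
    rw [← h.branch_eq i ⟨y, h.U_subset i hy⟩ hy, ← hGT]
  have hmeas : ∀ i, AEMeasurable (fun x => ‖Φ.branchTransfer ω i f x‖ₑ * G x) volume := fun i =>
    (h.aestronglyMeasurable_branchTransfer i hf.1).enorm.mul hG.aemeasurable
  rw [lintegral_congr_ae htsum, lintegral_tsum hmeas]
  simp_rw [hbranch, h.tsum_setLIntegral, ← hGT]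
  exact (lintegral_subtype_comap hC _).symm

theorem withDensity_transfer [Countable ι] (h : Φ.RegularFiber ω) (hC : MeasurableSet C)
    (hT : Measurable (Φ.T ω)) {f : E N → ℝ} (hfm : Measurable f) (hf : Integrable f)
    (hf0 : ∀ x, 0 ≤ f x) :
    volume.withDensity (fun x => ‖Φ.transfer ω f x‖ₑ) =
      ((volume.withDensity fun y : C => ‖f y‖ₑ).map (Φ.T ω)).map Subtype.val := by
  refine Measure.ext_of_lintegral _ fun G hG => ?_
  rw [lintegral_map hG measurable_subtype_coe, lintegral_map (by fun_prop) hT,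
    lintegral_withDensity_eq_lintegral_mul₀ (h.aestronglyMeasurable_transfer hf).enorm
      hG.aemeasurable,
    lintegral_withDensity_eq_lintegral_mul _ (by fun_prop) (by fun_prop)]
  exact h.lintegral_enorm_transfer_mul hC hf hf0 hG

end RegularFiber

end BranchedFamily

open ProbabilityTheory

section Ergodic

variable {X : Type*} [MeasurableSpace X]

theorem mutuallySingular_of_ergodic_of_ne {f : X → X} {μ ν : Measure X} [IsProbabilityMeasure μ]
    [IsProbabilityMeasure ν] (hμ : Ergodic f μ) (hν : Ergodic f ν) (hne : μ ≠ ν) : μ ⟂ₘ ν := by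
  have hle : ν.withDensity (μ.rnDeriv ν) ≤ μ := Measure.withDensity_rnDeriv_le μ ν
  have := isFiniteMeasure_of_le μ hle
  obtain ⟨c, hc⟩ := hν.eq_smul_of_absolutelyContinuous
    (hμ.toMeasurePreserving.withDensity_rnDeriv hν.toMeasurePreserving)
    (withDensity_absolutelyContinuous ν _)
  rcases eq_or_ne c 0 with rfl | hc0
  · rw [zero_smul] at hc
    exact (Measure.withDensity_rnDeriv_eq_zero μ ν).1 hc
  · have hνμ : ν ≪ μ :=
      (Measure.absolutelyContinuous_smul hc0).trans (hc ▸ hle.absolutelyContinuous)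
    exact absurd (hμ.eq_of_absolutelyContinuous hν.toMeasurePreserving hνμ).symm hne

theorem ae_eq_zero_or_eq_zero_of_mutuallySingular_withDensity {μ : Measure X}
    {f g : X → ℝ≥0∞} (hf : Measurable f) (hg : Measurable g)
    (h : μ.withDensity f ⟂ₘ μ.withDensity g) : ∀ᵐ x ∂μ, f x = 0 ∨ g x = 0 := by
  obtain ⟨s, -, hfs, hgs⟩ := h
  rw [withDensity_apply_eq_zero hf] at hfs
  rw [withDensity_apply_eq_zero hg] at hgs
  filter_upwards [measure_eq_zero_iff_ae_notMem.1 hfs, measure_eq_zero_iff_ae_notMem.1 hgs]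
    with x hxf hxg
  by_cases hxs : x ∈ s
  · exact Or.inl (not_not.1 fun hx => hxf ⟨hx, hxs⟩)
  · exact Or.inr (not_not.1 fun hx => hxg ⟨hx, hxs⟩)

variable {Ω : Type*} [MeasurableSpace Ω] {P : Measure Ω}

theorem fst_eq_of_semiconj [IsProbabilityMeasure P] {μ : Measure (Ω × X)} [IsProbabilityMeasure μ]
    {F : Ω × X → Ω × X} {σ : Ω → Ω} (hσ : Ergodic σ P) (hF : MeasurePreserving F μ μ)
    (hfst : Function.Semiconj Prod.fst F σ) (hac : μ.fst ≪ P) : μ.fst = P := by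
  refine hσ.eq_of_absolutelyContinuous ⟨hσ.measurable, ?_⟩ hac
  rw [Measure.fst, Measure.map_map hσ.measurable measurable_fst, ← hfst.comp_eq,
    ← Measure.map_map measurable_fst hF.measurable, hF.map_eq]

theorem ae_map_kernel_eq [IsFiniteMeasure P] [MeasurableSpace.CountablyGenerated X]
    {κ : Kernel Ω X} [IsFiniteKernel κ] {σ : Ω ≃ᵐ Ω} (hσ : MeasurePreserving σ P P)
    {T : Ω → X → X}
    (hF : MeasurePreserving (fun p : Ω × X => (σ p.1, T p.1 p.2)) (P ⊗ₘ κ) (P ⊗ₘ κ)) :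
    ∀ᵐ ω ∂P, κ (σ ω) = (κ ω).map (T ω) := by
  have hT : Measurable fun p : Ω × X => T p.1 p.2 := measurable_snd.comp hF.measurable
  let κT : Kernel Ω X := (Kernel.id ×ₖ κ).map fun p => T p.1 p.2
  have hκT : ∀ ω, κT ω = (κ ω).map (T ω) := fun ω => by
    rw [Kernel.map_apply _ hT, Kernel.prod_apply, Kernel.id_apply, Measure.dirac_prod,
      Measure.map_map hT measurable_prodMk_left]
    rfl
  have hcomp : P ⊗ₘ κ.comap σ σ.measurable = P ⊗ₘ κT := by
    ext s hs
    have hs' : MeasurableSet (Prod.map σ.symm id ⁻¹' s : Set (Ω × X)) :=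
      (σ.symm.measurable.prodMap measurable_id) hs
    calc (P ⊗ₘ κ.comap σ σ.measurable) s
        = ∫⁻ ω, κ (σ ω) (Prod.mk (σ ω) ⁻¹' (Prod.map σ.symm id ⁻¹' s)) ∂P := by
          rw [Measure.compProd_apply hs]
          simp [← preimage_comp, Function.comp_def]
      _ = (P ⊗ₘ κ) (Prod.map σ.symm id ⁻¹' s) := by
          rw [hσ.lintegral_comp (f := fun ω => κ ω (Prod.mk ω ⁻¹' (Prod.map σ.symm id ⁻¹' s)))
            (Kernel.measurable_kernel_prodMk_left hs'), Measure.compProd_apply hs']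
      _ = (P ⊗ₘ κT) s := by
          rw [← hF.measure_preimage hs'.nullMeasurableSet,
            Measure.compProd_apply (hF.measurable hs'), Measure.compProd_apply hs]
          refine lintegral_congr fun ω => ?_
          rw [hκT, Measure.map_apply (f := T ω) (hT.comp measurable_prodMk_left)
            (measurable_prodMk_left hs)]
          simp [← preimage_comp, Function.comp_def]
  filter_upwards [Kernel.ae_eq_of_compProd_eq hcomp] with ω hω
  rw [← hκT, ← hω, Kernel.comap_apply]

theorem exists_kernel_density [SFinite P] [MeasurableSpace.CountableOrCountablyGenerated Ω X]
    {κ : Kernel Ω X} [IsFiniteKernel κ] {ν : Measure X} [IsFiniteMeasure ν]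
    (h : P ⊗ₘ κ ≪ P.prod ν) :
    ∃ g : Ω → X → ℝ, Measurable (Function.uncurry g) ∧ (∀ ω x, 0 ≤ g ω x) ∧
      ∀ᵐ ω ∂P, κ ω = ν.withDensity fun x => ‖g ω x‖ₑ := by
  rw [← Measure.compProd_const] at h
  refine ⟨fun ω x => (κ.rnDeriv (Kernel.const Ω ν) ω x).toReal,
    (Kernel.measurable_rnDeriv κ _).ennreal_toReal, fun _ _ => ENNReal.toReal_nonneg, ?_⟩
  filter_upwards [h.kernel_of_compProd] with ω hω
  calc κ ω = ν.withDensity (κ.rnDeriv (Kernel.const Ω ν) ω) := by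
        conv_lhs => rw [← Kernel.withDensity_rnDeriv_eq hω]
        rw [Kernel.withDensity_apply _ (Kernel.measurable_rnDeriv _ _), Kernel.const_apply]
    _ = ν.withDensity fun x => ‖(κ.rnDeriv (Kernel.const Ω ν) ω x).toReal‖ₑ := by
        refine withDensity_congr_ae ?_
        filter_upwards [Kernel.rnDeriv_ne_top κ (Kernel.const Ω ν) (a := ω)] with x hx
        rw [Real.enorm_of_nonneg ENNReal.toReal_nonneg, ENNReal.ofReal_toReal hx]

end Ergodic

namespace BranchedFamily

variable {Ω ι : Type*} [MeasurableSpace Ω] {N : ℕ} {C : Set (E N)}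

attribute [local instance] Measure.Subtype.measureSpace

/-- The functions `H ω` are the densities, with respect to Lebesgue measure on `C`, of the
disintegration of the measure `μ` on `Ω × C` over its marginal `P`. -/
structure IsFiberDensity (P : Measure Ω) (μ : Measure (Ω × C)) (H : Ω → E N → ℝ) : Prop where
  measurable : Measurable (Function.uncurry H)
  nonneg : ∀ ω x, 0 ≤ H ω x
  eq_zero : ∀ ω x, x ∉ C → H ω x = 0
  exists_kernel : ∃ κ : Kernel Ω C, IsMarkovKernel κ ∧ P ⊗ₘ κ = μ ∧
    ∀ᵐ ω ∂P, κ ω = volume.withDensity fun x : C => ‖H ω x‖ₑ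

theorem exists_isFiberDensity {P : Measure Ω} [IsProbabilityMeasure P] (hC : IsCompact C)
    {μ : Measure (Ω × C)} [IsProbabilityMeasure μ] (hfst : μ.fst = P)
    (hμ : μ ≪ P.prod volume) : ∃ H, IsFiberDensity P μ H := by
  have : StandardBorelSpace C := hC.measurableSet.standardBorel
  have : Nonempty C := (nonempty_of_isProbabilityMeasure μ).map Prod.snd
  have : IsFiniteMeasure (volume : Measure C) := ⟨by
    rw [Measure.Subtype.volume_univ hC.measurableSet.nullMeasurableSet]
    exact hC.measure_lt_top⟩
  have hκ : P ⊗ₘ μ.condKernel = μ := by rw [← hfst, μ.disintegrate]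
  obtain ⟨g, hg, hg0, hκg⟩ :=
    exists_kernel_density (P := P) (κ := μ.condKernel) (ν := volume) (hκ.symm ▸ hμ)
  have hemb : MeasurableEmbedding (Prod.map id Subtype.val : Ω × C → Ω × E N) :=
    MeasurableEmbedding.id.prodMap (.subtype_coe hC.measurableSet)
  let H : Ω → E N → ℝ := Function.curry
    (Function.extend (Prod.map id Subtype.val) (Function.uncurry g) 0)
  have hH : ∀ ω (y : C), H ω y = g ω y := fun ω y => hemb.injective.extend_apply _ _ (ω, y)
  have hH0 : ∀ ω, ∀ x ∉ C, H ω x = 0 := fun ω x hx =>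
    Function.extend_apply' _ _ _ fun ⟨p, (hp : (p.1, (p.2 : E N)) = (ω, x))⟩ =>
      hx ((Prod.mk.inj hp).2 ▸ p.2.2)
  refine ⟨H, hemb.measurable_extend hg measurable_zero, fun ω x => ?_, hH0, μ.condKernel,
    inferInstance, hκ, by simpa only [hH] using hκg⟩
  by_cases hx : x ∈ C
  · exact (hg0 ω ⟨x, hx⟩).trans_eq (hH ω ⟨x, hx⟩).symm
  · exact (hH0 ω x hx).ge

namespace IsFiberDensity

variable {P : Measure Ω} {μ : Measure (Ω × C)} {H : Ω → E N → ℝ}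

theorem measurable_fiber (h : IsFiberDensity P μ H) (ω : Ω) : Measurable (H ω) :=
  h.measurable.comp measurable_prodMk_left

theorem map_withDensity (h : IsFiberDensity P μ H) (hC : MeasurableSet C) (ω : Ω) :
    ((volume.withDensity fun x : C => ‖H ω x‖ₑ).map Subtype.val) =
      volume.withDensity fun x => ‖H ω x‖ₑ := by
  ext s hs
  rw [Measure.map_apply measurable_subtype_coe hs,
    withDensity_apply _ (measurable_subtype_coe hs), withDensity_apply _ hs,
    ← lintegral_indicator hs, ← lintegral_indicator (measurable_subtype_coe hs)]
  have hsupp : Function.support (s.indicator fun x => ‖H ω x‖ₑ) ⊆ C := fun x hx => by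
    by_contra hxC
    simp [h.eq_zero ω x hxC] at hx
  rw [← setLIntegral_eq_of_support_subset hsupp]
  exact lintegral_subtype_comap hC (s.indicator fun x => ‖H ω x‖ₑ)

theorem ae_lintegral_eq_one (h : IsFiberDensity P μ H) (hC : MeasurableSet C) :
    ∀ᵐ ω ∂P, ∫⁻ x, ‖H ω x‖ₑ = 1 := by
  obtain ⟨κ, _, -, hκ⟩ := h.exists_kernel
  filter_upwards [hκ] with ω hω
  rw [← setLIntegral_univ, ← withDensity_apply _ MeasurableSet.univ, ← h.map_withDensity hC, ← hω,
    Measure.map_apply measurable_subtype_coe MeasurableSet.univ, preimage_univ, measure_univ]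

theorem ae_integrable (h : IsFiberDensity P μ H) (hC : MeasurableSet C) :
    ∀ᵐ ω ∂P, Integrable (H ω) := by
  filter_upwards [h.ae_lintegral_eq_one hC] with ω hω
  exact ⟨(h.measurable_fiber ω).aestronglyMeasurable, hω.trans_lt ENNReal.one_lt_top⟩

theorem ae_ae_eq_zero_or_eq_zero [SFinite P] (h : IsFiberDensity P μ H) (hC : MeasurableSet C)
    {μ' : Measure (Ω × C)} {H' : Ω → E N → ℝ} (h' : IsFiberDensity P μ' H') (hs : μ ⟂ₘ μ') :
    ∀ᵐ ω ∂P, ∀ᵐ x, H ω x = 0 ∨ H' ω x = 0 := by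
  obtain ⟨κ, _, rfl, hκ⟩ := h.exists_kernel
  obtain ⟨κ', _, rfl, hκ'⟩ := h'.exists_kernel
  filter_upwards [hκ, hκ', Measure.mutuallySingular_of_mutuallySingular_compProd hs .rfl .rfl]
    with ω hω hω' hsing
  rw [hω, hω'] at hsing
  have hmeas := (h.measurable_fiber ω).comp (measurable_subtype_coe (p := (· ∈ C)))
  have hmeas' := (h'.measurable_fiber ω).comp (measurable_subtype_coe (p := (· ∈ C)))
  have hae := ae_eq_zero_or_eq_zero_of_mutuallySingular_withDensity hmeas.enorm hmeas'.enorm hsing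
  filter_upwards [(ae_restrict_iff' hC).1 ((ae_restrict_iff_subtype hC
    (p := fun x => ‖H ω x‖ₑ = 0 ∨ ‖H' ω x‖ₑ = 0)).2 hae)] with x hx
  by_cases hxC : x ∈ C
  · simpa only [enorm_eq_zero] using hx hxC
  · exact Or.inl (h.eq_zero ω x hxC)

theorem ae_eq_transfer [Countable ι] [IsFiniteMeasure P] (h : IsFiberDensity P μ H)
    (hC : MeasurableSet C) {Φ : BranchedFamily Ω ι C} {σ : Ω ≃ᵐ Ω} (hσ : MeasurePreserving σ P P)
    (hμ : MeasurePreserving (Φ.skewProduct σ) μ μ) (hΦ : ∀ᵐ ω ∂P, Φ.RegularFiber ω) :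
    ∀ᵐ ω ∂P, H (σ ω) =ᵐ[volume] Φ.transfer ω (H ω) := by
  obtain ⟨κ, _, rfl, hκ⟩ := h.exists_kernel
  have hint := h.ae_integrable hC
  filter_upwards [hΦ, hκ, hσ.quasiMeasurePreserving.ae hκ, hint,
    hσ.quasiMeasurePreserving.ae hint, ae_map_kernel_eq hσ hμ] with ω hreg hω hσω hint hint' hmap
  have hT : Measurable (Φ.T ω) := measurable_snd.comp (hμ.measurable.comp measurable_prodMk_left)
  have hdens : volume.withDensity (fun x => ‖H (σ ω) x‖ₑ) =
      volume.withDensity fun x => ‖Φ.transfer ω (H ω) x‖ₑ := by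
    rw [hreg.withDensity_transfer hC hT (h.measurable_fiber ω) hint (h.nonneg ω), ← hω, ← hmap,
      hσω, h.map_withDensity hC]
  have hfin : ∫⁻ x, ‖H (σ ω) x‖ₑ ≠ ∞ := hint'.2.ne
  filter_upwards [(withDensity_eq_iff (h.measurable_fiber _).enorm.aemeasurable
    (hreg.aestronglyMeasurable_transfer hint).enorm hfin).1 hdens] with x hx
  rwa [Real.enorm_eq_ofReal (h.nonneg _ x),
    Real.enorm_eq_ofReal (Φ.transfer_nonneg ω (h.nonneg ω) x),
    ENNReal.ofReal_eq_ofReal_iff (h.nonneg _ x) (Φ.transfer_nonneg ω (h.nonneg ω) x)] at hx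

end IsFiberDensity

end BranchedFamily

section BackProd

variable {Ω : Type*} [MeasurableSpace Ω] {σ : Ω ≃ᵐ Ω} {η : Ω → ℝ}

theorem backProd_zero (ω : Ω) : backProd σ η 0 ω = 1 := by
  simp [backProd]

theorem backProd_succ (j : ℕ) (ω : Ω) :
    backProd σ η (j + 1) ω = η (σ.symm ω) * backProd σ η j (σ.symm ω) := by
  simp only [backProd, ← Finset.Ico_add_one_right_eq_Icc, Finset.prod_Ico_eq_prod_range,
    Nat.add_sub_cancel, Nat.add_comm 1, Finset.prod_range_succ', mul_comm]
  rfl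

theorem backProd_nonneg (hη : ∀ ω, 0 ≤ η ω) (j : ℕ) (ω : Ω) : 0 ≤ backProd σ η j ω :=
  Finset.prod_nonneg fun _ _ => hη _

variable {ξ : ℝ} {j₀ : Ω → ℕ} {ω : Ω}

theorem one_le_theta : 1 ≤ theta σ η ξ j₀ ω :=
  (Finset.le_fold_max _).2 (Or.inl le_rfl)

theorem backProd_le_theta_mul_pow (hξ : 0 < ξ)
    (h : ∀ j, 1 ≤ j → j₀ ω ≤ j → backProd σ η j ω < ξ ^ j) (j : ℕ) :
    backProd σ η j ω ≤ theta σ η ξ j₀ ω * ξ ^ j := by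
  have hp := pow_pos hξ j
  rcases Nat.eq_zero_or_pos j with rfl | hj
  · simpa [backProd_zero] using one_le_theta
  rcases le_total (j₀ ω) j with hj0 | hj0
  · exact (h j hj hj0).le.trans (le_mul_of_one_le_left hp.le one_le_theta)
  · rw [← div_le_iff₀ hp]
    exact (Finset.le_fold_max _).2 (Or.inr ⟨j, Finset.mem_Icc.2 ⟨hj, hj0⟩, le_rfl⟩)

theorem sum_backProd_le (hξ : 0 < ξ) (hξ' : ξ < 1)
    (h : ∀ j, 1 ≤ j → j₀ ω ≤ j → backProd σ η j ω < ξ ^ j) (n : ℕ) :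
    ∑ j ∈ Finset.range n, backProd σ η j ω ≤ theta σ η ξ j₀ ω / (1 - ξ) := by
  have hθ : 0 ≤ theta σ η ξ j₀ ω := zero_le_one.trans one_le_theta
  calc ∑ j ∈ Finset.range n, backProd σ η j ω
      ≤ ∑ j ∈ Finset.range n, theta σ η ξ j₀ ω * ξ ^ j :=
        Finset.sum_le_sum fun j _ => backProd_le_theta_mul_pow hξ h j
    _ = theta σ η ξ j₀ ω * ∑ j ∈ Finset.range n, ξ ^ j := by rw [Finset.mul_sum]
    _ ≤ theta σ η ξ j₀ ω * (1 - ξ)⁻¹ := by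
        gcongr
        rw [← tsum_geometric_of_lt_one hξ.le hξ']
        exact (summable_geometric_of_lt_one hξ.le hξ').sum_le_tsum _ fun _ _ => by positivity
    _ = theta σ η ξ j₀ ω / (1 - ξ) := (div_eq_mul_inv _ _).symm

end BackProd

theorem MemV.eLpNorm_lt_top {N : ℕ} {C : Set (E N)} {α e : ℝ} {f : E N → ℝ} (hf : MemV C α e f) :
    eLpNorm f 1 volume < ∞ :=
  (memLp_one_iff_integrable.2 hf.integrable).2

theorem MemV.oscNorm_lt_top {N : ℕ} {C : Set (E N)} {α e : ℝ} {f : E N → ℝ} (hf : MemV C α e f) :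
    oscNorm α e f < ∞ :=
  ENNReal.add_lt_top.2 ⟨hf.eLpNorm_lt_top, hf.finite⟩

namespace BranchedFamily

open Filter

variable {Ω ι : Type*} [MeasurableSpace Ω] {N : ℕ} {C : Set (E N)}

/-- The cocycle `L_{σ⁻¹ω} ∘ ⋯ ∘ L_{σ⁻ⁿω}` of transfer operators along the backward orbit of `ω`,
in the paper `L_{σ⁻ⁿω}^{(n)}`. -/
noncomputable def backTransfer (Φ : BranchedFamily Ω ι C) (σ : Ω ≃ᵐ Ω) :
    ℕ → Ω → (E N → ℝ) → E N → ℝ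
  | 0, _, f => f
  | n + 1, ω, f => Φ.transfer (σ.symm ω) (Φ.backTransfer σ n (σ.symm ω) f)

variable [Countable ι] {Φ : BranchedFamily Ω ι C} {P : Measure Ω} {σ : Ω ≃ᵐ Ω} {α e D : ℝ}
  {η : Ω → ℝ}

theorem ae_memV_backTransfer (hσ : Measure.QuasiMeasurePreserving σ.symm P P)
    (hΦ : ∀ᵐ ω ∂P, Φ.RegularFiber ω) (hLY : Φ.LasotaYorke P α e η D) (n : ℕ) :
    ∀ᵐ ω ∂P, ∀ f, MemV C α e f → MemV C α e (Φ.backTransfer σ n ω f) := by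
  induction n with
  | zero => exact .of_forall fun _ _ hf => hf
  | succ n ih =>
    filter_upwards [hσ.ae ih, hσ.ae hΦ, hσ.ae hLY] with ω ih hreg hLY f hf
    have hfin : oscNorm α e (Φ.backTransfer σ (n + 1) ω f) < ∞ :=
      (hLY _ (ih f hf)).trans_lt (ENNReal.add_lt_top.2
        ⟨ENNReal.mul_lt_top ENNReal.ofReal_lt_top (ih f hf).oscNorm_lt_top,
          ENNReal.mul_lt_top ENNReal.ofReal_lt_top (ih f hf).eLpNorm_lt_top⟩)
    exact ⟨hreg.integrable_transfer (ih f hf).integrable,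
      .of_forall fun _ => hreg.transfer_eq_zero _, (self_le_add_left _ _).trans_lt hfin⟩

theorem ae_integrable_backTransfer (hσ : Measure.QuasiMeasurePreserving σ.symm P P)
    (hΦ : ∀ᵐ ω ∂P, Φ.RegularFiber ω) (n : ℕ) :
    ∀ᵐ ω ∂P, ∀ f, Integrable f → Integrable (Φ.backTransfer σ n ω f) := by
  induction n with
  | zero => exact .of_forall fun _ _ hf => hf
  | succ n ih =>
    filter_upwards [hσ.ae ih, hσ.ae hΦ] with ω ih hreg f hf
    exact hreg.integrable_transfer (ih f hf)

theorem ae_eLpNorm_backTransfer_le (hσ : Measure.QuasiMeasurePreserving σ.symm P P)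
    (hΦ : ∀ᵐ ω ∂P, Φ.RegularFiber ω) (n : ℕ) :
    ∀ᵐ ω ∂P, ∀ f, Integrable f →
      eLpNorm (Φ.backTransfer σ n ω f) 1 volume ≤ eLpNorm f 1 volume := by
  induction n with
  | zero => exact .of_forall fun _ _ _ => le_rfl
  | succ n ih =>
    filter_upwards [hσ.ae ih, hσ.ae hΦ, hσ.ae (ae_integrable_backTransfer hσ hΦ n)]
      with ω ih hreg hint f hf
    exact (hreg.eLpNorm_transfer_le (hint f hf).1).trans (ih f hf)

theorem ae_eLpNorm_sub_backTransfer_le (hσ : Measure.QuasiMeasurePreserving σ.symm P P)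
    (hΦ : ∀ᵐ ω ∂P, Φ.RegularFiber ω) {H : Ω → E N → ℝ} (hH : ∀ᵐ ω ∂P, Integrable (H ω))
    (htr : ∀ᵐ ω ∂P, H (σ ω) =ᵐ[volume] Φ.transfer ω (H ω)) (n : ℕ) :
    ∀ᵐ ω ∂P, ∀ f, Integrable f →
      eLpNorm (H ω - Φ.backTransfer σ n ω f) 1 volume ≤
        eLpNorm (H (σ.symm^[n] ω) - f) 1 volume := by
  induction n with
  | zero => exact .of_forall fun _ _ _ => le_rfl
  | succ n ih =>
    filter_upwards [hσ.ae ih, hσ.ae hΦ, hσ.ae hH, hσ.ae htr,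
      hσ.ae (ae_integrable_backTransfer hσ hΦ n)] with ω ih hreg hH htr hint f hf
    rw [MeasurableEquiv.apply_symm_apply] at htr
    rw [eLpNorm_congr_ae (htr.sub EventuallyEq.rfl)]
    exact (hreg.eLpNorm_transfer_sub_le hH (hint f hf)).trans (ih f hf)

theorem ae_oscNorm_backTransfer_le (hσ : Measure.QuasiMeasurePreserving σ.symm P P)
    (hΦ : ∀ᵐ ω ∂P, Φ.RegularFiber ω) (hη : ∀ ω, 0 ≤ η ω) (hLY : Φ.LasotaYorke P α e η D) (n : ℕ) :
    ∀ᵐ ω ∂P, ∀ f, MemV C α e f → oscNorm α e (Φ.backTransfer σ n ω f) ≤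
      ENNReal.ofReal (backProd σ η n ω) * oscNorm α e f +
        ENNReal.ofReal (D * ∑ j ∈ Finset.range n, backProd σ η j ω) * eLpNorm f 1 volume := by
  induction n with
  | zero => exact .of_forall fun ω f _ => by simp [backTransfer, backProd_zero]
  | succ n ih =>
    filter_upwards [hσ.ae ih, hσ.ae hLY, hσ.ae (ae_memV_backTransfer hσ hΦ hLY n),
      hσ.ae (ae_eLpNorm_backTransfer_le hσ hΦ n)] with ω ih hLY hmem hnorm f hf
    have hsum : 0 ≤ ∑ j ∈ Finset.range n, backProd σ η j (σ.symm ω) :=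
      Finset.sum_nonneg fun j _ => backProd_nonneg hη j _
    have hsucc : ∑ j ∈ Finset.range (n + 1), backProd σ η j ω =
        η (σ.symm ω) * ∑ j ∈ Finset.range n, backProd σ η j (σ.symm ω) + 1 := by
      simp only [Finset.sum_range_succ', backProd_zero, backProd_succ, Finset.mul_sum]
    calc oscNorm α e (Φ.backTransfer σ (n + 1) ω f)
        ≤ ENNReal.ofReal (η (σ.symm ω)) * oscNorm α e (Φ.backTransfer σ n (σ.symm ω) f) +
            ENNReal.ofReal D * eLpNorm (Φ.backTransfer σ n (σ.symm ω) f) 1 volume :=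
          hLY _ (hmem f hf)
      _ ≤ ENNReal.ofReal (η (σ.symm ω)) *
            (ENNReal.ofReal (backProd σ η n (σ.symm ω)) * oscNorm α e f +
              ENNReal.ofReal (D * ∑ j ∈ Finset.range n, backProd σ η j (σ.symm ω)) *
                eLpNorm f 1 volume) + ENNReal.ofReal D * eLpNorm f 1 volume := by
          gcongr
          exacts [ih f hf, hnorm f hf.integrable]
      _ = _ := by
          rw [hsucc, backProd_succ, ENNReal.ofReal_mul (hη _), ENNReal.ofReal_mul' hsum,
            ENNReal.ofReal_mul' (add_nonneg (mul_nonneg (hη _) hsum) zero_le_one),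
            ENNReal.ofReal_add (mul_nonneg (hη _) hsum) zero_le_one, ENNReal.ofReal_mul (hη _),
            ENNReal.ofReal_one]
          ring

variable {ξ : ℝ} {j₀ : Ω → ℕ}

theorem ae_oscNorm_backTransfer_le_theta (hσ : Measure.QuasiMeasurePreserving σ.symm P P)
    (hΦ : ∀ᵐ ω ∂P, Φ.RegularFiber ω) (hη : ∀ ω, 0 ≤ η ω) (hLY : Φ.LasotaYorke P α e η D)
    (hξ : 0 < ξ) (hξ' : ξ < 1)
    (hj₀ : ∀ᵐ ω ∂P, ∀ j, 1 ≤ j → j₀ ω ≤ j → backProd σ η j ω < ξ ^ j) (n : ℕ) :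
    ∀ᵐ ω ∂P, ∀ f, MemV C α e f → oscNorm α e (Φ.backTransfer σ n ω f) ≤
      ENNReal.ofReal (theta σ η ξ j₀ ω * ξ ^ n) * oscNorm α e f +
        ENNReal.ofReal (D * (theta σ η ξ j₀ ω / (1 - ξ))) * eLpNorm f 1 volume := by
  filter_upwards [ae_oscNorm_backTransfer_le hσ hΦ hη hLY n, hj₀] with ω hn hj₀ f hf
  have hsum0 : 0 ≤ ∑ j ∈ Finset.range n, backProd σ η j ω :=
    Finset.sum_nonneg fun j _ => backProd_nonneg hη j ω
  have hsum := sum_backProd_le hξ hξ' hj₀ n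
  refine (hn f hf).trans ?_
  rw [ENNReal.ofReal_mul' hsum0, ENNReal.ofReal_mul' (hsum0.trans hsum)]
  gcongr
  exact backProd_le_theta_mul_pow hξ hj₀ n

end BranchedFamily

theorem tendsto_ofReal_mul_pow_mul {ξ : ℝ} (hξ : 0 ≤ ξ) (hξ' : ξ < 1) (a : ℝ) {M : ℝ≥0∞}
    (hM : M ≠ ∞) :
    Filter.Tendsto (fun n : ℕ => ENNReal.ofReal (a * ξ ^ n) * M) Filter.atTop (𝓝 0) := by
  have hpow := ENNReal.tendsto_ofReal
    ((tendsto_pow_atTop_nhds_zero_of_lt_one hξ hξ').const_mul a)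
  simpa using ENNReal.Tendsto.mul_const hpow (Or.inr hM)

namespace BranchedFamily.IsFiberDensity

open Filter

variable {Ω ι : Type*} [MeasurableSpace Ω] {N : ℕ} {C : Set (E N)} [Countable ι]
  {Φ : BranchedFamily Ω ι C} {P : Measure Ω} [IsProbabilityMeasure P] {σ : Ω ≃ᵐ Ω}
  {α e D ξ : ℝ} {η : Ω → ℝ} {j₀ : Ω → ℕ} {μ : Measure (Ω × C)} {H : Ω → E N → ℝ}

-- The backward orbit of `ω` returns to fibres `σ⁻ⁿω` at which the density is close to `H ω`, so
-- that an approximation `φ` of `H ω` is pushed forward to one that the cocycle has regularized.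
theorem ae_exists_memV_approx (h : IsFiberDensity P μ H) (hC : IsCompact C)
    (hσ : MeasurePreserving σ P P) (hμ : MeasurePreserving (Φ.skewProduct σ) μ μ)
    (hΦ : ∀ᵐ ω ∂P, Φ.RegularFiber ω) (hα : α ≤ 1) (hη : ∀ ω, 0 ≤ η ω)
    (hLY : Φ.LasotaYorke P α e η D) (hξ : 0 < ξ) (hξ' : ξ < 1)
    (hj₀ : ∀ᵐ ω ∂P, ∀ j, 1 ≤ j → j₀ ω ≤ j → backProd σ η j ω < ξ ^ j) :
    ∀ᵐ ω ∂P, ∀ δ : ℝ, 0 < δ → ∃ u, MemV C α e u ∧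
      eLpNorm (u - H ω) 1 volume ≤ ENNReal.ofReal δ + ENNReal.ofReal δ ∧
      oscSeminorm α e u ≤ ENNReal.ofReal δ +
        ENNReal.ofReal (D * (theta σ η ξ j₀ ω / (1 - ξ))) * (1 + ENNReal.ofReal δ) := by
  obtain ⟨ω₀, hω₀⟩ := hΦ.exists
  have hσ' : MeasurePreserving σ.symm P P := hσ.symm σ
  have hqmp := hσ'.quasiMeasurePreserving
  have hint := h.ae_integrable hC.measurableSet
  have htr := h.ae_eq_transfer hC.measurableSet hσ hμ hΦ
  filter_upwards [ae_frequently_eLpNorm_sub_lt (μ := volume) hσ'.conservative h.measurable,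
    h.ae_lintegral_eq_one hC.measurableSet, hint,
    ae_all_iff.2 fun n => (hσ'.iterate n).quasiMeasurePreserving.ae hint,
    ae_all_iff.2 (ae_memV_backTransfer hqmp hΦ hLY),
    ae_all_iff.2 (ae_eLpNorm_sub_backTransfer_le hqmp hΦ hint htr),
    ae_all_iff.2 (ae_oscNorm_backTransfer_le_theta hqmp hΦ hη hLY hξ hξ' hj₀)]
    with ω hreturn hone hint hint_orbit hmem hdist hosc δ hδ
  have hδ' : 0 < ENNReal.ofReal δ := ENNReal.ofReal_pos.2 hδ
  obtain ⟨φ, hφ, hφH⟩ := exists_memV_eLpNorm_sub_le (e := e) hC hω₀.volume_diff_interior hα hint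
    (.of_forall fun x => h.eq_zero ω x) hδ
  have hφ_norm : eLpNorm φ 1 volume ≤ 1 + ENNReal.ofReal δ := by
    calc eLpNorm φ 1 volume = eLpNorm (H ω - (H ω - φ)) 1 volume := by rw [sub_sub_cancel]
      _ ≤ eLpNorm (H ω) 1 volume + eLpNorm (H ω - φ) 1 volume :=
        eLpNorm_sub_le hint.1 (hint.sub hφ.integrable).1 le_rfl
      _ ≤ 1 + ENNReal.ofReal δ := by
        gcongr
        rw [eLpNorm_one_eq_lintegral_enorm, hone]
  obtain ⟨n, hn_return, hn_small⟩ := ((hreturn hint _ hδ'.ne').and_eventually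
    ((tendsto_ofReal_mul_pow_mul hξ.le hξ' (theta σ η ξ j₀ ω)
      hφ.oscNorm_lt_top.ne).eventually_le_const hδ')).exists
  refine ⟨Φ.backTransfer σ n ω φ, hmem n φ hφ, ?_, ?_⟩
  · rw [eLpNorm_sub_comm]
    calc eLpNorm (H ω - Φ.backTransfer σ n ω φ) 1 volume
        ≤ eLpNorm (H (σ.symm^[n] ω) - φ) 1 volume := hdist n φ hφ.integrable
      _ = eLpNorm (H (σ.symm^[n] ω) - H ω + (H ω - φ)) 1 volume := by rw [sub_add_sub_cancel]
      _ ≤ eLpNorm (H (σ.symm^[n] ω) - H ω) 1 volume + eLpNorm (H ω - φ) 1 volume :=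
        eLpNorm_add_le ((hint_orbit n).sub hint).1 (hint.sub hφ.integrable).1 le_rfl
      _ ≤ _ := add_le_add hn_return.le hφH
  · calc oscSeminorm α e (Φ.backTransfer σ n ω φ)
        ≤ oscNorm α e (Φ.backTransfer σ n ω φ) := self_le_add_left _ _
      _ ≤ _ := (hosc n φ hφ).trans (by gcongr)

theorem ae_oscSeminorm_le (h : IsFiberDensity P μ H) (hC : IsCompact C)
    (hσ : MeasurePreserving σ P P) (hμ : MeasurePreserving (Φ.skewProduct σ) μ μ)
    (hΦ : ∀ᵐ ω ∂P, Φ.RegularFiber ω) (hα : α ≤ 1) (hη : ∀ ω, 0 ≤ η ω)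
    (hLY : Φ.LasotaYorke P α e η D) (hξ : 0 < ξ) (hξ' : ξ < 1)
    (hj₀ : ∀ᵐ ω ∂P, ∀ j, 1 ≤ j → j₀ ω ≤ j → backProd σ η j ω < ξ ^ j) :
    ∀ᵐ ω ∂P, oscSeminorm α e (H ω) ≤ ENNReal.ofReal (D * (theta σ η ξ j₀ ω / (1 - ξ))) := by
  filter_upwards [h.ae_exists_memV_approx hC hσ hμ hΦ hα hη hLY hξ hξ' hj₀] with ω happrox
  choose u hu huH hosc using fun l : ℕ => happrox (1 / (l + 1)) Nat.one_div_pos_of_nat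
  have hδ : Tendsto (fun l : ℕ => ENNReal.ofReal (1 / (l + 1))) atTop (𝓝 0) := by
    simpa using ENNReal.tendsto_ofReal tendsto_one_div_add_atTop_nhds_zero_nat
  refine oscSeminorm_le_of_tendsto_eLpNorm (fun l => (hu l).integrable.1)
    (h.measurable_fiber ω).aestronglyMeasurable ?_ hosc ?_
  · exact tendsto_of_tendsto_of_tendsto_of_le_of_le tendsto_const_nhds
      (by simpa using hδ.add hδ) (fun _ => zero_le) huH
  · simpa using hδ.add (ENNReal.Tendsto.const_mul
      (a := ENNReal.ofReal (D * (theta σ η ξ j₀ ω / (1 - ξ)))) (hδ.const_add 1) (by simp))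

end BranchedFamily.IsFiberDensity

section EssInf

variable {Ω : Type*} [MeasurableSpace Ω] {P : Measure Ω} [NeZero P] {f : Ω → ℝ} {q : ℝ}

theorem exists_frequently_le (f : Ω → ℝ) : ∃ K : ℝ, ∃ᶠ ω in ae P, f ω ≤ K := by
  by_contra! h
  have hnat : ∀ᵐ ω ∂P, ∀ n : ℕ, n < f ω := ae_all_iff.2 fun n => h n
  obtain ⟨ω, hω⟩ := hnat.exists
  obtain ⟨n, hn⟩ := exists_nat_ge (f ω)
  exact (hω n).not_ge hn

theorem le_mul_essInf (hq : 0 ≤ q) {a : ℝ} (h : ∀ᵐ ω ∂P, a ≤ q * f ω) : a ≤ q * essInf f P := by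
  rcases hq.eq_or_lt with rfl | hq
  · simpa using h
  rw [← div_le_iff₀' hq]
  obtain ⟨K, hK⟩ := exists_frequently_le (P := P) f
  exact Filter.le_liminf_of_le (Filter.IsCoboundedUnder.of_frequently_le hK)
    (h.mono fun ω hω => (div_le_iff₀' hq).2 hω)

theorem finite_and_ncard_le_of_forall_finset {X : Type*} {A : Set X} (hq : 0 ≤ q)
    (h : ∀ F : Finset X, ↑F ⊆ A → ∀ᵐ ω ∂P, (F.card : ℝ) ≤ q * f ω) :
    A.Finite ∧ (A.ncard : ℝ) ≤ q * essInf f P := by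
  have hcard : ∀ F : Finset X, ↑F ⊆ A → (F.card : ℝ) ≤ q * essInf f P :=
    fun F hF => le_mul_essInf hq (h F hF)
  have hfin : A.Finite := by
    by_contra hinf
    obtain ⟨n, hn⟩ := exists_nat_gt (q * essInf f P)
    obtain ⟨F, hF, rfl⟩ := Set.Infinite.exists_subset_card_eq hinf n
    exact hn.not_ge (hcard F hF)
  rw [ncard_eq_toFinset_card A hfin]
  exact ⟨hfin, hcard hfin.toFinset hfin.coe_toFinset.subset⟩

end EssInf

section Counting

variable {N : ℕ} {C : Set (E N)}

theorem card_mul_volume_ball_le {κ : Type*} (F : Finset κ) {f : κ → E N → ℝ} {ρ : ℝ}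
    (hf0 : ∀ k ∈ F, ∀ x, x ∉ C → f k x = 0)
    (hpos : ∀ k ∈ F, ∃ x, ∀ᵐ y ∂volume.restrict (Metric.ball x ρ), 0 < f k y)
    (hdisj : ∀ k ∈ F, ∀ l ∈ F, k ≠ l → ∀ᵐ y, f k y = 0 ∨ f l y = 0) :
    F.card * volume (Metric.ball (0 : E N) ρ) ≤ volume C := by
  choose! x hx using hpos
  replace hx : ∀ k ∈ F, ∀ᵐ y, y ∈ Metric.ball (x k) ρ → 0 < f k y := fun k hk =>
    (ae_restrict_iff' Metric.isOpen_ball.measurableSet).1 (hx k hk)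
  have hballs : (F : Set κ).Pairwise
      (Function.onFun (AEDisjoint volume) fun k => Metric.ball (x k) ρ) := by
    intro k hk l hl hkl
    refine measure_eq_zero_iff_ae_notMem.2 ?_
    filter_upwards [hx k hk, hx l hl, hdisj k hk l hl hkl] with y hyk hyl hy hmem
    exact hy.elim (hyk hmem.1).ne' (hyl hmem.2).ne'
  have hsub : (⋃ k ∈ F, Metric.ball (x k) ρ) ≤ᵐ[volume] C := by
    filter_upwards [(ae_ball_iff F.countable_toSet).2 hx] with y hy hyU
    obtain ⟨k, hk, hyk⟩ := mem_iUnion₂.1 hyU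
    by_contra hyC
    exact (hy k hk hyk).ne' (hf0 k hk y hyC)
  calc (F.card : ℝ≥0∞) * volume (Metric.ball (0 : E N) ρ)
      = ∑ k ∈ F, volume (Metric.ball (x k) ρ) := by simp [Measure.addHaar_ball_center]
    _ = volume (⋃ k ∈ F, Metric.ball (x k) ρ) :=
        (measure_biUnion_finset₀ hballs
          fun k _ => Metric.isOpen_ball.measurableSet.nullMeasurableSet).symm
    _ ≤ volume C := measure_mono_ae hsub

theorem card_le_of_mul_volume_ball_le {n : ℕ} {T α : ℝ} (hT : 0 < T) (hC : volume C ≠ ∞)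
    (h : n * volume (Metric.ball (0 : E N) (T ^ (-1 / α))) ≤ volume C) :
    (n : ℝ) ≤ volume.real C / volume.real (Metric.ball (0 : E N) 1) * T ^ ((N : ℝ) / α) := by
  have hρ : 0 < T ^ (-1 / α) := Real.rpow_pos_of_pos hT _
  have hγ : 0 < volume.real (Metric.ball (0 : E N) 1) :=
    ENNReal.toReal_pos (Metric.measure_ball_pos _ _ one_pos).ne' measure_ball_lt_top.ne
  have hpow : (T ^ (-1 / α)) ^ N * T ^ ((N : ℝ) / α) = 1 := by
    rw [← Real.rpow_natCast, ← Real.rpow_mul hT.le, ← Real.rpow_add hT,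
      show -1 / α * N + N / α = 0 by ring, Real.rpow_zero]
  rw [Measure.addHaar_ball_of_pos _ _ hρ, finrank_euclideanSpace, Fintype.card_fin] at h
  have hreal : n * ((T ^ (-1 / α)) ^ N * volume.real (Metric.ball (0 : E N) 1)) ≤
      volume.real C := by
    simpa [ENNReal.toReal_ofReal, hρ.le, Measure.real] using ENNReal.toReal_mono hC h
  rw [div_mul_eq_mul_div, le_div_iff₀ hγ]
  calc (n : ℝ) * volume.real (Metric.ball (0 : E N) 1)
      = n * ((T ^ (-1 / α)) ^ N * volume.real (Metric.ball (0 : E N) 1)) *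
          T ^ ((N : ℝ) / α) := by
        linear_combination (-(n : ℝ) * volume.real (Metric.ball (0 : E N) 1)) * hpow
    _ ≤ volume.real C * T ^ ((N : ℝ) / α) := by gcongr

end Counting

section BigTheta

variable {Ω : Type*} [MeasurableSpace Ω] {N : ℕ} {C : Set (E N)} {σ : Ω ≃ᵐ Ω} {η : Ω → ℝ}
  {D ξ : ℝ} {j₀ : Ω → ℕ} {ω : Ω}

theorem mul_one_add_le_bigTheta (hmC : 1 ≤ volume.real C) (hD : 0 ≤ D) (hξ' : ξ < 1) :
    D * (1 + theta σ η ξ j₀ ω / (1 - ξ)) ≤ bigTheta C σ η D ξ j₀ ω := by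
  have hθ : 0 ≤ theta σ η ξ j₀ ω / (1 - ξ) :=
    div_nonneg (zero_le_one.trans one_le_theta) (sub_nonneg.2 hξ'.le)
  exact mul_le_mul_of_nonneg_right (le_mul_of_one_le_right hD hmC) (by positivity)

theorem mul_theta_div_lt_bigTheta (hmC : 1 ≤ volume.real C) (hD : 0 < D) (hξ' : ξ < 1) :
    D * (theta σ η ξ j₀ ω / (1 - ξ)) < bigTheta C σ η D ξ j₀ ω :=
  (mul_lt_mul_of_pos_left (lt_one_add _) hD).trans_le (mul_one_add_le_bigTheta hmC hD.le hξ')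

theorem le_bigTheta {a : ℝ} (hmC : 1 ≤ volume.real C) (ha : 0 ≤ a) (hξ : 1 / 2 < ξ) (hξ' : ξ < 1)
    (hD : ξ * a ≤ D) : a ≤ bigTheta C σ η D ξ j₀ ω := by
  have hD0 : 0 ≤ D := (mul_nonneg (by linarith) ha).trans hD
  have hθ₁ : 1 ≤ theta σ η ξ j₀ ω := one_le_theta
  have hθ : 1 ≤ theta σ η ξ j₀ ω / (1 - ξ) :=
    (one_le_div (by linarith)).2 (by linarith)
  calc a ≤ ξ * a * 2 := by nlinarith
    _ ≤ D * (1 + theta σ η ξ j₀ ω / (1 - ξ)) := by gcongr; linarith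
    _ ≤ bigTheta C σ η D ξ j₀ ω := mul_one_add_le_bigTheta hmC hD0 hξ'

end BigTheta

namespace BranchedFamily

variable {Ω ι : Type*} [MeasurableSpace Ω] {P : Measure Ω} [IsProbabilityMeasure P] {σ : Ω ≃ᵐ Ω}
  {N : ℕ} {C : Set (E N)} {Φ : BranchedFamily Ω ι C} {α e D ξ : ℝ} {η Θ : Ω → ℝ} {j₀ : Ω → ℕ}

theorem exists_isFiberDensity_of_mem_ergodicACIPs (hC : IsCompact C) (hσ : Ergodic σ P)
    {μ : Measure (Ω × C)} (hμ : μ ∈ Φ.ergodicACIPs σ P) : ∃ H, IsFiberDensity P μ H := by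
  obtain ⟨_, herg, hac⟩ := hμ
  refine exists_isFiberDensity hC (fst_eq_of_semiconj hσ herg.toMeasurePreserving
    (fun _ => rfl) ?_) hac
  exact (hac.map measurable_fst).trans Measure.quasiMeasurePreserving_fst.absolutelyContinuous

theorem ae_card_le [Countable ι] (hσ : Ergodic σ P) (hC : IsCompact C) (hα : 0 < α) (hα' : α ≤ 1)
    (he : 0 < e) (hΦ : ∀ᵐ ω ∂P, Φ.RegularFiber ω) (hη : ∀ ω, 0 ≤ η ω)
    (hLY : Φ.LasotaYorke P α e η D) (hξ : 0 < ξ) (hξ' : ξ < 1)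
    (hj₀ : ∀ᵐ ω ∂P, ∀ j, 1 ≤ j → j₀ ω ≤ j → backProd σ η j ω < ξ ^ j)
    (heΘ : ∀ᵐ ω ∂P, e ^ (-α) ≤ Θ ω)
    (hDΘ : ∀ᵐ ω ∂P, D * (theta σ η ξ j₀ ω / (1 - ξ)) < Θ ω)
    {F : Finset (Measure (Ω × C))} (hF : ↑F ⊆ Φ.ergodicACIPs σ P) :
    ∀ᵐ ω ∂P, (F.card : ℝ) ≤
      volume.real C / volume.real (Metric.ball (0 : E N) 1) * Θ ω ^ ((N : ℝ) / α) := by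
  choose! H hH using fun μ hμ => exists_isFiberDensity_of_mem_ergodicACIPs hC hσ (hF (a := μ) hμ)
  have hosc : ∀ᵐ ω ∂P, ∀ μ ∈ F, oscSeminorm α e (H μ ω) ≤
      ENNReal.ofReal (D * (theta σ η ξ j₀ ω / (1 - ξ))) :=
    (ae_ball_iff F.countable_toSet).2 fun μ hμ =>
      (hH μ hμ).ae_oscSeminorm_le hC hσ.toMeasurePreserving (hF hμ).2.1.toMeasurePreserving hΦ hα'
        hη hLY hξ hξ' hj₀
  have hone : ∀ᵐ ω ∂P, ∀ μ ∈ F, ∫⁻ x, ‖H μ ω x‖ₑ = 1 :=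
    (ae_ball_iff F.countable_toSet).2 fun μ hμ => (hH μ hμ).ae_lintegral_eq_one hC.measurableSet
  have hdisj : ∀ᵐ ω ∂P, ∀ μ ∈ F, ∀ ν ∈ F, μ ≠ ν → ∀ᵐ x, H μ ω x = 0 ∨ H ν ω x = 0 := by
    refine (ae_ball_iff F.countable_toSet).2 fun μ hμ => (ae_ball_iff F.countable_toSet).2
      fun ν hν => Filter.eventually_imp_distrib_left.2 fun hne => ?_
    have := (hF hμ).1
    have := (hF hν).1
    exact (hH μ hμ).ae_ae_eq_zero_or_eq_zero hC.measurableSet (hH ν hν)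
      (mutuallySingular_of_ergodic_of_ne (hF hμ).2.1 (hF hν).2.1 hne)
  filter_upwards [hosc, hone, hdisj, heΘ, hDΘ] with ω hosc hone hdisj heΘ hDΘ
  have hΘ : 0 < Θ ω := (Real.rpow_pos_of_pos he _).trans_le heΘ
  refine card_le_of_mul_volume_ball_le hΘ hC.measure_lt_top.ne (card_mul_volume_ball_le F
    (fun μ hμ => (hH μ hμ).eq_zero ω) (fun μ hμ => ?_) hdisj)
  refine exists_ball_ae_pos_of_oscSeminorm_lt hα he heΘ ?_
    ((hosc μ hμ).trans_lt ((ENNReal.ofReal_lt_ofReal_iff hΘ).2 hDΘ))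
  simpa only [Real.enorm_of_nonneg ((hH μ hμ).nonneg ω _)] using hone μ hμ

end BranchedFamily

end Saussol

theorem theorem6p1_general
    {Ω ι : Type*} [MeasurableSpace Ω] [Countable ι] {P : Measure Ω} [IsProbabilityMeasure P]
    {σ : Ω ≃ᵐ Ω} (hσ : Ergodic σ P) {N : ℕ} {C : Set (Saussol.E N)} (hC : IsCompact C)
    {α e : ℝ} (hα : 0 < α) (hα' : α ≤ 1) (he : 0 < e)
    {Φ : Saussol.BranchedFamily Ω ι C} (hΦ : ∀ᵐ ω ∂P, Φ.RegularFiber ω)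
    {η : Ω → ℝ} {D ξ : ℝ} {j₀ : Ω → ℕ} (hη : ∀ ω, 0 ≤ η ω) (hLY : Φ.LasotaYorke P α e η D)
    (hξ : 0 < ξ) (hξ' : ξ < 1)
    (hj₀ : ∀ᵐ ω ∂P, ∀ j, 1 ≤ j → j₀ ω ≤ j → Saussol.backProd σ η j ω < ξ ^ j)
    {Θ : Ω → ℝ} (heΘ : ∀ᵐ ω ∂P, e ^ (-α) ≤ Θ ω)
    (hDΘ : ∀ᵐ ω ∂P, D * (Saussol.theta σ η ξ j₀ ω / (1 - ξ)) < Θ ω) :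
    (Φ.ergodicACIPs σ P).Finite ∧
      ((Φ.ergodicACIPs σ P).ncard : ℝ) ≤
        volume.real C / volume.real (Metric.ball (0 : Saussol.E N) 1) *
          essInf (fun ω => Θ ω ^ ((N : ℝ) / α)) P :=
  Saussol.finite_and_ncard_le_of_forall_finset (by positivity) fun _ =>
    Saussol.BranchedFamily.ae_card_le hσ hC hα hα' he hΦ hη hLY hξ hξ' hj₀ heΘ hDΘ

theorem theorem6p1
    {Ω ι : Type*} [TopologicalSpace Ω] [MeasurableSpace Ω] [BorelSpace Ω] [Countable ι]
    (P : Measure Ω) [IsProbabilityMeasure P]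
    (σ : Ω ≃ᵐ Ω) (hσ : Ergodic σ P)
    (N : ℕ) (hN : 1 < N)
    (C : Set (Saussol.E N)) (hC : IsCompact C) (hC' : (closure (interior C)).Nonempty)
    (α ε₀ e : ℝ) (hα : 0 < α) (hα' : α ≤ 1) (hε₀ : 0 < ε₀) (he : 0 < e)
    (s : Ω → ℝ) (S c : ℝ)
    (Φ : Saussol.BranchedFamily Ω ι C) (hΦ : Φ.IsRandomSaussol P α ε₀ e s S c)
    (hlog : ∫⁻ ω, (ENNReal.log (Φ.transferNorm α e ω)).toENNReal ∂P < ∞)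
    (hmC : 1 ≤ volume.real C)
    (Θ : Ω → ℝ) (hΘ : Saussol.IsTheta Φ P σ α e Θ) :
    (Φ.ergodicACIPs σ P).Finite ∧
      ((Φ.ergodicACIPs σ P).ncard : ℝ) ≤
        volume.real C / volume.real (Metric.ball (0 : Saussol.E N) 1) *
          essInf (fun ω => Θ ω ^ ((N : ℝ) / α)) P := by
  obtain ⟨η, D, ξ, j₀, -, hη, hLY, hξ, hξ', hD, -, hj₀, rfl⟩ := hΘ
  have hξ0 : 0 < ξ := by linarith
  have he0 : 0 < e ^ (-α) := Real.rpow_pos_of_pos he _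
  have hD0 : 0 < D := (mul_pos hξ0 he0).trans_le hD
  exact theorem6p1_general hσ hC hα hα' he hΦ.ae_regularFiber (fun ω => (hη ω).le) hLY hξ0 hξ' hj₀
    (.of_forall fun _ => Saussol.le_bigTheta hmC he0.le hξ hξ' hD)
    (.of_forall fun _ => Saussol.mul_theta_div_lt_bigTheta hmC hD0 hξ')
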